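/- Surfaces are compact, connected, orientable and without boundary. For a simple graph $G$ let $\lambda(G)$ be the second largest eigenvalue (with multiplicity) of its adjacency matrix. Let $G$ be a simple four-regular graph cellularly embedded on a surface $\mathscr{S}$ (every face is an open disk), and let $\delta\ge 1$ be an integer. The graph $G^\delta$ is obtained as follows. Replace each vertex $u$ of $G$ by a $(\delta\times\delta)$-grid, and divide the boundary of the grid into four contiguous segments of $\delta$ vertices, each starting at a corner, in clockwise order (each corner is in two segments; for $\delta=1$ all four segments consist of the single vertex). Assign the four segments to the four half-edges of $G$ at $u$, one to each, so that their clockwise orders around the grid and around $u$ in the embedding agree. For each edge $uv$ of $G$ and each $i\in\{1,\dots,\delta\}$, add an edge between the $i$-th vertex of the segment of the grid of $u$ that is assigned to $uv$ and the $(\delta-i+1)$-st vertex of the segment of the grid of $v$ that is assigned to $uv$. For every constant $c<1$ there is a constant $C>0$, depending only on $c$, such that the following holds for all $\mathscr{S}$, all such $G$ with $\lambda(G)/4<c$, all integers $\delta\ge1$ and all admissible assignments of segments: the graph $G^\delta$ can be cellularly embedded on $\mathscr{S}$, it has $\delta^2\,|V(G)|$ vertices, and its treewidth is at least $C\,\delta\,|V(G)|$.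 -/

import Mathlib

universe u v

/-- The `k`-th eigenvalue, in non-increasing order with multiplicities and counted from `0`,
is `eigenvalues₀ k`; so this is `λ(G)`, the second largest eigenvalue of the adjacency matrix.
(The value `0` for graphs with fewer than two vertices is a convention.) -/
noncomputable def SimpleGraph.secondEigenvalue {V : Type u} [Fintype V] [DecidableEq V]
    (G : SimpleGraph V) [DecidableRel G.Adj] : ℝ :=
  if h : 1 < Fintype.card V then
    Matrix.IsHermitian.eigenvalues₀ (A := G.adjMatrix ℝ)
      (by rw [Matrix.IsHermitian, Matrix.conjTranspose_eq_transpose_of_trivial]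
          exact G.isSymm_adjMatrix) ⟨1, h⟩
  else 0

/-- A tree decomposition of `G`, with index tree on `Fin m`. -/
structure SimpleGraph.TreeDecomposition {V : Type u} (G : SimpleGraph V) (m : ℕ) where
  tree : SimpleGraph (Fin m)
  isTree : tree.IsTree
  bag : Fin m → Finset V
  exists_bag_of_adj : ∀ ⦃x y : V⦄, G.Adj x y → ∃ t, x ∈ bag t ∧ y ∈ bag t
  /-- The nodes whose bags contain a given vertex induce a nonempty connected subtree. -/
  connected_bags : ∀ x : V, (tree.induce {t | x ∈ bag t}).Connected

/-- The treewidth of a finite graph: the least `w` such that some tree decomposition has all its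
bags of size at most `w + 1`. -/
noncomputable def SimpleGraph.treewidth {V : Type u} (G : SimpleGraph V) : ℕ :=
  sInf {w | ∃ (m : ℕ) (D : G.TreeDecomposition m), ∀ t, (D.bag t).card ≤ w + 1}

/-- An embedding (crossing-free drawing) of a simple graph on a topological space. Every edge
gives two darts, which carry the same simple path in its two directions. -/
structure GraphEmbedding {V : Type u} (G : SimpleGraph V) (S : Type v) [TopologicalSpace S] where
  point : V → S
  arc : ∀ d : G.Dart, Path (point d.fst) (point d.snd)
  arc_symm : ∀ d, arc d.symm = (arc d).symm
  point_injective : Function.Injective point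
  arc_injective : ∀ d, Function.Injective (arc d)
  /-- An edge meets (the image of) a vertex only at its endpoints. -/
  arc_ne_point : ∀ (d : G.Dart) (t : unitInterval) (x : V), arc d t = point x → t = 0 ∨ t = 1
  /-- The interiors of distinct edges are disjoint. -/
  edge_eq_of_arc_eq : ∀ (d e : G.Dart) (s t : unitInterval),
    s ≠ 0 → s ≠ 1 → t ≠ 0 → t ≠ 1 → arc d s = arc e t → d.edge = e.edge

namespace GraphEmbedding

variable {V : Type u} {G : SimpleGraph V} {S : Type v} [TopologicalSpace S]

/-- The image of the graph. -/
def image (E : GraphEmbedding G S) : Set S :=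
  Set.range E.point ∪ ⋃ d : G.Dart, Set.range (E.arc d)

/-- Every face, i.e. connected component of the complement of the graph, is an open disk. -/
def IsCellular (E : GraphEmbedding G S) : Prop :=
  ∀ x ∈ E.imageᶜ,
    Nonempty (connectedComponentIn E.imageᶜ x ≃ₜ Metric.ball (0 : EuclideanSpace ℝ (Fin 2)) 1)

end GraphEmbedding

/-- `G` can be cellularly embedded on `S`. -/
def SimpleGraph.CellularlyEmbeddable {V : Type u} (G : SimpleGraph V)
    (S : Type v) [TopologicalSpace S] : Prop :=
  ∃ E : GraphEmbedding G S, E.IsCellular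

/-- A rotation system of `G`: a cyclic ordering of the half-edges (darts, i.e. oriented edges,
identified with the half-edge at their origin) around each vertex. The dart `next d` is the
one that follows `d` in clockwise order around the origin of `d`. -/
structure RotationSystem {V : Type u} (G : SimpleGraph V) where
  next : Equiv.Perm G.Dart
  next_fst : ∀ d, (next d).fst = d.fst
  sameCycle : ∀ d e : G.Dart, d.fst = e.fst → next.SameCycle d e

namespace RotationSystem

variable {V : Type u} {G : SimpleGraph V}

/-- One unit square for each dart `d`, thought of as a neighbourhood of the corner (face angle)
between the consecutive half-edges `d` and `next d`, in the face to which this corner belongs.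
The point `(0, 0)` is the origin of `d`, the point `(1, 1)` is the centre of the face,
`(1, 0)` is the midpoint of the edge of `d` and `(0, 1)` the midpoint of the edge of `next d`. -/
abbrev Corners (_R : RotationSystem G) : Type u :=
  Σ _ : G.Dart, unitInterval × unitInterval

/-- The identifications between the sides of the squares. -/
inductive Glue (R : RotationSystem G) : R.Corners → R.Corners → Prop
  /-- The corner `(d, next d)` and the corner `(next d, next (next d))` are glued along the first
  half of the edge of `next d`. -/
  | halfEdge (d : G.Dart) (t : unitInterval) : Glue R ⟨d, (0, t)⟩ ⟨R.next d, (t, 0)⟩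
  /-- The corner `(d, next d)` and the corner `(e, next e)` at the other end of the edge of `d`,
  where `next e` is the reverse of `d`, are consecutive in a common face; they are glued along
  the segment from the midpoint of the edge of `d` to the centre of that face. -/
  | face (d e : G.Dart) (h : R.next e = d.symm) (t : unitInterval) :
      Glue R ⟨d, (1, t)⟩ ⟨e, (t, 1)⟩

/-- The oriented surface that a rotation system determines: one polygonal disk for every facial
walk is glued to the graph along the walk, where each polygonal disk is cut, from its centre to
the midpoints of its sides, into one square for each of its corners. -/
abbrev Surface (R : RotationSystem G) : Type u := Quot R.Glue

/-- `R` is the rotation system of the cellular embedding `E` of `G` on `S` (for one of the two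
orientations of `S`): the surface `S`, together with the graph drawn on it, is obtained from `G` by
gluing disks, the faces, along the facial walks that `R` prescribes. Here `h` identifies the side
`(t, 0)` of the corner at `d` with the first half of the arc of `d`. -/
def IsRotationSystemOf (R : RotationSystem G) {S : Type v} [TopologicalSpace S]
    (E : GraphEmbedding G S) : Prop :=
  ∃ h : R.Surface ≃ₜ S, ∀ (d : G.Dart) (t : unitInterval),
    h (Quot.mk R.Glue ⟨d, (t, 0)⟩) = (E.arc d).extend ((t : ℝ) / 2)

/-- A choice, at each vertex of a four-regular graph, of one of the four sides `0, 1, 2, 3` (in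
clockwise order) of a square for each of the half-edges, which respects the cyclic ordering. -/
structure SideChoice (R : RotationSystem G) where
  side : G.Dart → Fin 4
  side_next : ∀ d, side (R.next d) = side d + 1

end RotationSystem

/-- The four segments of `δ` vertices into which the boundary of the `δ × δ` grid is divided, each
starting at a corner, in clockwise order along the boundary (top, right, bottom, left; the first
coordinate increases to the right and the second one upwards). -/
def gridSegment {δ : ℕ} (k : Fin 4) (i : Fin δ) : Fin δ × Fin δ :=
  match k with
  | 0 => (i, ⟨δ - 1, by have := i.isLt; omega⟩)
  | 1 => (⟨δ - 1, by have := i.isLt; omega⟩, i.rev)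
  | 2 => (i.rev, ⟨0, i.pos⟩)
  | 3 => (⟨0, i.pos⟩, i)

/-- The blow-up `G^δ`: every vertex is replaced by a `δ × δ` grid, and every edge `uv` by `δ` edges
that join the `i`-th vertex of a segment of the grid of `u` to the `(δ - i + 1)`-st vertex of a
segment of the grid of `v` (counted from `1`). -/
def RotationSystem.SideChoice.blowUp {V : Type u} {G : SimpleGraph V} {R : RotationSystem G}
    (σ : R.SideChoice) (δ : ℕ) : SimpleGraph (V × (Fin δ × Fin δ)) where
  Adj x y :=
    (x.1 = y.1 ∧ ((SimpleGraph.pathGraph δ).boxProd (SimpleGraph.pathGraph δ)).Adj x.2 y.2) ∨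
    ∃ d : G.Dart, d.fst = x.1 ∧ d.snd = y.1 ∧
      ∃ i : Fin δ, x.2 = gridSegment (σ.side d) i ∧ y.2 = gridSegment (σ.side d.symm) i.rev
  symm := ⟨by
    rintro x y (⟨h, h'⟩ | ⟨d, hx, hy, i, hi, hj⟩)
    · exact Or.inl ⟨h.symm, h'.symm⟩
    · exact Or.inr ⟨d.symm, hy, hx, i.rev, hj, by simpa using hi⟩⟩
  loopless := ⟨by
    rintro x (⟨_, h⟩ | ⟨d, hx, hy, _⟩)
    · exact h.ne rfl
    · exact d.adj.ne (hx.trans hy.symm)⟩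

/-- In a four-regular graph, sides can be chosen for every rotation system. -/
theorem RotationSystem.nonempty_sideChoice {V : Type u} [Fintype V] [DecidableEq V]
    {G : SimpleGraph V} [DecidableRel G.Adj] (hG : G.IsRegularOfDegree 4)
    (R : RotationSystem G) : Nonempty R.SideChoice := by
  classical
  let s : V → Finset G.Dart := fun v => Finset.univ.filter (fun d => d.fst = v)
  have hcard : ∀ v, (s v).card = 4 := fun v => by
    rw [← hG v]; exact G.dart_fst_fiber_card_eq_degree v
  have hcyc : ∀ v, R.next.IsCycleOn (s v) := fun v => by
    refine ⟨⟨?_, R.next.injective.injOn, ?_⟩, ?_⟩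
    · intro d hd
      simpa [s, R.next_fst] using hd
    · intro d hd
      refine ⟨R.next.symm d, ?_, by simp⟩
      have := R.next_fst (R.next.symm d)
      simp only [Equiv.apply_symm_apply] at this
      simp only [s, Finset.coe_filter, Finset.mem_univ, true_and, Set.mem_ofPred_eq] at hd ⊢
      exact this.symm.trans hd
    · intro d hd e he
      simp only [s, Finset.coe_filter, Finset.mem_univ, true_and, Set.mem_ofPred_eq] at hd he
      exact R.sameCycle d e (hd.trans he.symm)
  have hne : ∀ v, ∃ d, d ∈ s v := fun v => Finset.card_pos.mp (by rw [hcard]; norm_num)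
  choose b hb using hne
  have hmem : ∀ d : G.Dart, d ∈ s d.fst := fun d => by simp [s]
  have hpow : ∀ d : G.Dart, ∃ k : ℕ, (R.next ^ k) (b d.fst) = d := fun d => by
    obtain ⟨k, _, hk⟩ := (hcyc d.fst).exists_pow_eq (hb d.fst) (hmem d)
    exact ⟨k, hk⟩
  choose k hk using hpow
  refine ⟨⟨fun d => Fin.ofNat 4 (k d), fun d => ?_⟩⟩
  have h1 : (R.next ^ k (R.next d)) (b d.fst) = (R.next ^ (k d + 1)) (b d.fst) := by
    rw [pow_succ', Equiv.Perm.mul_apply, hk d, ← R.next_fst d, hk]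
  have h2 := ((hcyc d.fst).pow_apply_eq_pow_apply (hb d.fst)).mp h1
  rw [hcard] at h2
  ext
  simp only [Fin.ofNat, Fin.val_add]
  have h3 : k (R.next d) % 4 = (k d + 1) % 4 := h2
  simp [h3]

/-! The treewidth bound and the embedding are independent arguments.

Treewidth: some bag `X` of an optimal tree decomposition is a balanced separator
(`TreeDecomposition.exists_balanced`): outside `X` the vertices carry labels, constant along edges,
and no label is used by more than half of all vertices. Call a vertex of `G` good if `X` takes fewer
than `δ / 16` vertices of its grid. The rows and columns of a good grid that avoid `X` cross each
other and so share one label. Between two adjacent good grids, one of the `δ` parallel edges joins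
two such lines, so both have the same label. Hence all edges that leave a class of equally labelled
good vertices end in bad vertices. Balance bounds such a class by `128 / 225` of `V`, so the easy
half of Cheeger's inequality (`secondEigenvalue_mul_card_le`) gives it a number of outgoing edges
proportional to its size. Summing over the classes, the bad vertices form a positive fraction of
`V`, and each contributes at least `δ / 16` vertices to `X` (`mul_card_le_of_balanced`).

Embedding: the four corners at a vertex fit together to the square `[-1, 1]²`, and the surface
consists of these squares glued side to side. Draw in each square `δ` equally spaced lines in both
directions, at distance `2 / δ` from each other and `1 / δ` from the sides; across a common side
they continue each other. The lines form the drawing of the blow-up (`embedding`,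
`mem_image_embedding`).

Two adjacent squares without their outer boundary form an open rectangle `doubleSquare`. Its chart
extends to a map of the whole surface by collapsing everything else to a point, so continuity can be
checked on the quotient; compactness then makes the inverse continuous. A point off the lines lies
either in a rectangle between consecutive lines, visible in one chart
(`nonempty_homeomorph_of_double`), or beyond the last lines near a corner of a square. The face
there is a shrunken copy of a face of `G`: stretching every corner maps it homeomorphically onto the
original face (`nonempty_facePart_homeomorph`), which is a disk because `E` is cellular. -/

namespace SimpleGraph

/-! ### Branches of trees and balanced bags of tree decompositions -/

/-- In a tree, the nodes that are closer to `s` than to `t`; for adjacent `s` and `t` this is the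
branch at `t` that contains `s`. -/
def branch {T : Type*} (H : SimpleGraph T) (t s : T) : Set T :=
  {r | H.dist s r < H.dist t r}

theorem Connected.exists_adj_mem_branch {T : Type*} {H : SimpleGraph T} (hH : H.Connected)
    {t r : T} (h : r ≠ t) : ∃ s, H.Adj t s ∧ r ∈ H.branch t s := by
  obtain ⟨p, hp⟩ := hH.exists_walk_length_eq_dist t r
  cases p with
  | nil => exact absurd rfl h
  | @cons _ s _ hadj q =>
    refine ⟨s, hadj, ?_⟩
    have := dist_le q
    simp only [Walk.length_cons] at hp
    simp only [branch, Set.mem_ofPred_eq]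
    omega

/-- A node in the branch of `s` is reached from `t` by a shortest path through `s`, and paths in a
tree are unique. -/
theorem IsTree.branch_unique {T : Type*} {H : SimpleGraph T} (hH : H.IsTree) {t s s' r : T}
    (hs : H.Adj t s) (hs' : H.Adj t s') (h : r ∈ H.branch t s) (h' : r ∈ H.branch t s') :
    s = s' := by
  have key : ∀ x, H.Adj t x → r ∈ H.branch t x →
      ∃ p : H.Walk t r, p.IsPath ∧ p.snd = x := by
    intro x hx hr
    obtain ⟨q, hq⟩ := hH.connected.exists_walk_length_eq_dist x r
    refine ⟨Walk.cons hx q, ?_, by simp⟩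
    apply Walk.isPath_of_length_eq_dist
    have h1 := hH.dist_eq_dist_add_one_of_adj r hx
    simp only [branch, Set.mem_ofPred_eq] at hr
    rw [dist_comm (u := r), dist_comm (u := r)] at h1
    simp only [Walk.length_cons]
    omega
  obtain ⟨p, hp, rfl⟩ := key s hs h
  obtain ⟨q, hq, rfl⟩ := key s' hs' h'
  rw [(hH.existsUnique_path t r).unique hp hq]

/-- Only `t` connects its branches: were `r'` outside the branch of `s`, distances to the two ends
of the edge would put `r` in the branch that contains `r'`, and `branch_unique` would identify the
two branches. -/
theorem IsTree.mem_branch_of_adj {T : Type*} {H : SimpleGraph T} (hH : H.IsTree) {t s r r' : T}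
    (hs : H.Adj t s) (h : r ∈ H.branch t s) (hr : H.Adj r r') (hne : r' ≠ t) :
    r' ∈ H.branch t s := by
  obtain ⟨s', hs', h'⟩ := hH.connected.exists_adj_mem_branch hne
  have h1 := hH.dist_eq_dist_add_one_of_adj t hr
  have h2 := hH.dist_eq_dist_add_one_of_adj s hr
  have h3 := hH.dist_eq_dist_add_one_of_adj s' hr
  have h4 : ∀ x, H.Adj t x → H.dist t r = H.dist x r + 1 ∨ H.dist x r = H.dist t r + 1 := by
    intro x hx
    have := hH.dist_eq_dist_add_one_of_adj r hx
    rwa [dist_comm (u := r), dist_comm (u := r)] at this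
  have h5 := h4 s hs
  have h6 := h4 s' hs'
  simp only [branch, Set.mem_ofPred_eq] at h h' ⊢
  by_cases hc : H.dist s r' < H.dist t r'
  · exact hc
  · have : r ∈ H.branch t s' := by
      simp only [branch, Set.mem_ofPred_eq]; omega
    rw [hH.branch_unique hs hs' h this]
    exact h'

theorem IsTree.subset_branch {T : Type*} {H : SimpleGraph T} (hH : H.IsTree) {t s : T}
    (hs : H.Adj t s) {A : Set T} (hA : (H.induce A).Connected) (ht : t ∉ A) {r : T} (hr : r ∈ A)
    (h : r ∈ H.branch t s) : A ⊆ H.branch t s := by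
  intro q hq
  obtain ⟨p⟩ := hA.preconnected ⟨r, hr⟩ ⟨q, hq⟩
  have : ∀ (a b : A) (_ : (H.induce A).Walk a b), (a : T) ∈ H.branch t s →
      (b : T) ∈ H.branch t s := by
    intro a b w
    induction w with
    | nil => exact id
    | @cons x y z hxy _ ih =>
      intro hx
      exact ih (hH.mem_branch_of_adj hs hx hxy fun e => ht (e ▸ y.2))
  exact this _ _ p h

/-- A tree decomposition has a bag that is a balanced separator: `br x` is the branch of the tree,
at the node of this bag, in which the bags that contain `x` lie. -/
theorem TreeDecomposition.exists_balanced {V : Type u} [Fintype V] [DecidableEq V]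
    {G : SimpleGraph V} {m : ℕ} (D : G.TreeDecomposition m) :
    ∃ (t : Fin m) (br : V → Fin m),
      (∀ x y, G.Adj x y → x ∉ D.bag t → y ∉ D.bag t → br x = br y) ∧
      ∀ k, 2 * (Finset.univ.filter fun x => x ∉ D.bag t ∧ br x = k).card ≤ Fintype.card V := by
  classical
  set H := D.tree
  have hH : H.IsTree := D.isTree
  have hsub : ∀ (t s : Fin m) (x : V) (r : Fin m), H.Adj t s → x ∉ D.bag t → x ∈ D.bag r →
      r ∈ H.branch t s → {q | x ∈ D.bag q} ⊆ H.branch t s := fun t s x r hs hx hr h =>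
    hH.subset_branch hs (D.connected_bags x) hx hr h
  -- For `x` in the bag of `t` no branch is meaningful and `t` itself serves as a dummy value.
  have hex : ∀ (t : Fin m) (x : V), ∃ s, x ∉ D.bag t →
      H.Adj t s ∧ {q | x ∈ D.bag q} ⊆ H.branch t s := by
    intro t x
    by_cases hx : x ∈ D.bag t
    · exact ⟨t, fun h => absurd hx h⟩
    · obtain ⟨⟨r, hr⟩⟩ := (D.connected_bags x).nonempty
      have hne : r ≠ t := by rintro rfl; exact hx hr
      obtain ⟨s, hs, h⟩ := hH.connected.exists_adj_mem_branch hne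
      exact ⟨s, fun _ => ⟨hs, hsub t s x r hs hx hr h⟩⟩
  choose br hbr using hex
  have hadj : ∀ t x y, G.Adj x y → x ∉ D.bag t → y ∉ D.bag t → br t x = br t y := by
    intro t x y hxy hx hy
    obtain ⟨r, hr, hr'⟩ := D.exists_bag_of_adj hxy
    exact hH.branch_unique (hbr t x hx).1 (hbr t y hy).1 ((hbr t x hx).2 hr) ((hbr t y hy).2 hr')
  -- Otherwise every node `t` points to a neighbour `f t` whose branch carries a strict majority of
  -- the vertices. Two majorities intersect, so any two of these branches share a node. A node whose
  -- branch is smallest gives a contradiction, since moving on to `f t` makes the branch smaller.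
  by_contra hcon
  push Not at hcon
  have hbig : ∀ t, ∃ s, Fintype.card V <
      2 * (Finset.univ.filter fun x => x ∉ D.bag t ∧ br t x = s).card :=
    fun t => hcon t (br t) (hadj t)
  choose f hf using hbig
  have hf' : ∀ t, H.Adj t (f t) := by
    intro t
    have : 0 < (Finset.univ.filter fun x => x ∉ D.bag t ∧ br t x = f t).card := by
      have := hf t; omega
    obtain ⟨x, hx⟩ := Finset.card_pos.mp this
    simp only [Finset.mem_filter, Finset.mem_univ, true_and] at hx
    rw [← hx.2]
    exact (hbr t x hx.1).1
  have hmeet : ∀ t s, ∃ r, r ∈ H.branch t (f t) ∧ r ∈ H.branch s (f s) := by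
    intro t s
    have : ¬ Disjoint (Finset.univ.filter fun x => x ∉ D.bag t ∧ br t x = f t)
        (Finset.univ.filter fun x => x ∉ D.bag s ∧ br s x = f s) := by
      intro hd
      have h1 := Finset.card_union_of_disjoint hd
      have h2 := Finset.card_le_univ ((Finset.univ.filter fun x => x ∉ D.bag t ∧ br t x = f t) ∪
        (Finset.univ.filter fun x => x ∉ D.bag s ∧ br s x = f s))
      have := hf t
      have := hf s
      omega
    rw [Finset.not_disjoint_iff] at this
    obtain ⟨x, hx, hx'⟩ := this
    simp only [Finset.mem_filter, Finset.mem_univ, true_and] at hx hx'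
    obtain ⟨⟨r, hr⟩⟩ := (D.connected_bags x).nonempty
    refine ⟨r, ?_, ?_⟩
    · rw [← hx.2]; exact (hbr t x hx.1).2 hr
    · rw [← hx'.2]; exact (hbr s x hx'.1).2 hr
  have : Nonempty (Fin m) := hH.connected.nonempty
  obtain ⟨t, ht⟩ := Finite.exists_min fun t => (H.branch t (f t)).ncard
  have hlt : (H.branch (f t) (f (f t))).ncard < (H.branch t (f t)).ncard := by
    apply Set.ncard_lt_ncard _ (Set.toFinite _)
    rw [Set.ssubset_iff_of_subset]
    · refine ⟨f t, ?_, ?_⟩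
      · have := (dist_eq_one_iff_adj.mpr (hf' t))
        simp [branch, this]
      · simp [branch]
    · intro q hq
      by_contra hq'
      have h1 := hH.dist_eq_dist_add_one_of_adj q (hf' t)
      rw [dist_comm (u := q), dist_comm (u := q)] at h1
      have h2 : q ∈ H.branch (f t) t := by
        simp only [branch, Set.mem_ofPred_eq] at hq' ⊢; omega
      -- A node outside the old branch could be in the new one only if `f t` points back to `t`; but
      -- the two opposite branches of an edge are disjoint, contrary to `hmeet`.
      have h3 : t = f (f t) := hH.branch_unique (hf' t).symm (hf' (f t)) h2 hq
      obtain ⟨r, hr, hr'⟩ := hmeet t (f t)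
      rw [← h3] at hr'
      simp only [branch, Set.mem_ofPred_eq] at hr hr'
      omega
  exact absurd (ht (f t)) (not_le.mpr hlt)

/-- The decomposition with a single bag. -/
def TreeDecomposition.single {V : Type u} [Fintype V] (G : SimpleGraph V) :
    G.TreeDecomposition 1 where
  tree := ⊥
  isTree := IsTree.of_subsingleton
  bag := fun _ => Finset.univ
  exists_bag_of_adj := fun x y _ => ⟨0, by simp⟩
  connected_bags := fun x => by
    have : Nonempty {t : Fin 1 | x ∈ (Finset.univ : Finset V)} := ⟨⟨0, by simp⟩⟩
    exact (IsTree.of_subsingleton (G := (⊥ : SimpleGraph (Fin 1)).induce _)).connected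

theorem exists_treeDecomposition_treewidth {V : Type u} [Fintype V] (G : SimpleGraph V) :
    ∃ (m : ℕ) (D : G.TreeDecomposition m), ∀ t, (D.bag t).card ≤ G.treewidth + 1 := by
  have : G.treewidth ∈ {w | ∃ (m : ℕ) (D : G.TreeDecomposition m), ∀ t, (D.bag t).card ≤ w + 1} :=
    Nat.sInf_mem ⟨Fintype.card V, 1, TreeDecomposition.single G, fun t =>
      (Finset.card_le_univ _).trans (Nat.le_succ _)⟩
  exact this

/-- The two ends of an edge share a bag. Positivity later allows `w + 1` to be replaced by `2 * w`
in the bound on bags, so that no additive constant remains. -/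
theorem one_le_treewidth {V : Type u} [Fintype V] {G : SimpleGraph V} {x y : V}
    (h : G.Adj x y) : 1 ≤ G.treewidth := by
  obtain ⟨m, D, hD⟩ := G.exists_treeDecomposition_treewidth
  obtain ⟨t, hx, hy⟩ := D.exists_bag_of_adj h
  have := hD t
  have : 1 < (D.bag t).card := Finset.one_lt_card.mpr ⟨x, hx, y, hy, h.ne⟩
  omega

end SimpleGraph

/-! ### The spectral gap and the size of cuts -/

namespace SimpleGraph

open Finset in
/-- The easy direction of Cheeger's inequality, for the sizes of cuts. -/
theorem IsRegularOfDegree.secondEigenvalue_mul_card_le {V : Type u} [Fintype V] [DecidableEq V]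
    {G : SimpleGraph V} [DecidableRel G.Adj] {k : ℕ} (hG : G.IsRegularOfDegree k)
    (hV : 1 < Fintype.card V) (hlam : G.secondEigenvalue < k) (S : Finset V) :
    (k - G.secondEigenvalue) * (S.card * (Fintype.card V - S.card)) ≤
      Fintype.card V * ∑ x ∈ S, ∑ y ∈ Sᶜ, G.adjMatrix ℝ x y := by
  classical
  have hA : (G.adjMatrix ℝ).IsHermitian := by
    rw [Matrix.IsHermitian, Matrix.conjTranspose_eq_transpose_of_trivial]
    exact G.isSymm_adjMatrix
  set lam := G.secondEigenvalue with hlamdef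
  set A := G.adjMatrix ℝ with hAdef
  have hlam1 : lam = hA.eigenvalues₀ ⟨1, hV⟩ := by
    rw [hlamdef, secondEigenvalue, dif_pos hV]
  let e := Fintype.equivOfCardEq (Fintype.card_fin (Fintype.card V)) (β := V)
  -- `eigenvalues` is indexed by `V` through `e`, so `o` is the index of the largest eigenvalue and
  -- all others are bounded by the second largest.
  set o : V := e ⟨0, by omega⟩ with ho
  have hle : ∀ i, i ≠ o → hA.eigenvalues i ≤ lam := by
    intro i hi
    rw [hlam1]
    apply hA.eigenvalues₀_antitone
    rw [Fin.le_def]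
    have : e.symm i ≠ ⟨0, by omega⟩ := by
      intro h
      apply hi
      rw [ho, ← h, Equiv.apply_symm_apply]
    have h2 : (e.symm i).val ≠ 0 := fun h => this (Fin.ext h)
    exact Nat.one_le_iff_ne_zero.mpr h2
  set b := hA.eigenvectorBasis
  have hinner : ∀ x y : EuclideanSpace ℝ V, inner ℝ x y = x.ofLp ⬝ᵥ y.ofLp := by
    intro x y
    rw [EuclideanSpace.inner_eq_star_dotProduct, star_trivial, dotProduct_comm]
  have hmv : ∀ (i : V) (x : V → ℝ), (b i).ofLp ⬝ᵥ A.mulVec x =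
      hA.eigenvalues i * ((b i).ofLp ⬝ᵥ x) := by
    intro i x
    rw [Matrix.dotProduct_mulVec, ← Matrix.mulVec_transpose]
    have : A.transpose = A := G.isSymm_adjMatrix
    rw [this, hA.mulVec_eigenvectorBasis, smul_dotProduct, smul_eq_mul]
  have hparseval : ∀ x y : V → ℝ,
      x ⬝ᵥ y = ∑ i, ((b i).ofLp ⬝ᵥ x) * ((b i).ofLp ⬝ᵥ y) := by
    intro x y
    have := b.sum_inner_mul_inner (WithLp.toLp 2 x) (WithLp.toLp 2 y)
    rw [hinner] at this
    rw [show x ⬝ᵥ y = _ from this.symm]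
    refine Finset.sum_congr rfl fun i _ => ?_
    rw [hinner, hinner]
    simp only [dotProduct_comm]
  set one : V → ℝ := fun _ => 1 with hone
  have hA1 : A.mulVec one = fun _ => (k : ℝ) := by
    funext v
    have := G.adjMatrix_mulVec_const_apply_of_regular (d := k) (a := (1 : ℝ)) hG (v := v)
    exact this.trans (mul_one _)
  -- The constant vector is an eigenvector for `k`, and the eigenvalues other than the one at `o`
  -- are below `k`; hence it is a multiple of `b o`.
  have hperp : ∀ i, i ≠ o → (b i).ofLp ⬝ᵥ one = 0 := by
    intro i hi
    have h1 := hmv i one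
    have h2 : (b i).ofLp ⬝ᵥ A.mulVec one = k * ((b i).ofLp ⬝ᵥ one) := by
      rw [hA1]
      simp only [hone, dotProduct, mul_one, ← Finset.sum_mul]
      exact mul_comm _ _
    have h3 : (k - hA.eigenvalues i) * ((b i).ofLp ⬝ᵥ one) = 0 := by linarith
    rcases mul_eq_zero.mp h3 with h | h
    · have := hle i hi; linarith
    · exact h
  set α := (b o).ofLp ⬝ᵥ one with hα
  have hsum1 : ∀ y : V → ℝ, one ⬝ᵥ y = α * ((b o).ofLp ⬝ᵥ y) := by
    intro y
    rw [hparseval, Finset.sum_eq_single o]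
    · intro i _ hi; rw [hperp i hi, zero_mul]
    · simp
  have hα2 : α * α = Fintype.card V := by
    rw [← hsum1 one]; simp [dotProduct, hone]
  have hlamo : hA.eigenvalues o = k := by
    have h1 := hmv o one
    have h2 : (b o).ofLp ⬝ᵥ A.mulVec one = k * α := by
      rw [hA1]
      simp only [hα, hone, dotProduct, mul_one, ← Finset.sum_mul]
      exact mul_comm _ _
    have h3 : α ≠ 0 := by
      rintro h
      rw [h] at hα2
      have : (0 : ℝ) < Fintype.card V := by exact_mod_cast (by omega : 0 < Fintype.card V)
      linarith
    rw [h2] at h1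
    exact (mul_right_cancel₀ h3 h1).symm
  set x : V → ℝ := fun v => if v ∈ S then 1 else 0 with hx
  have hxx : x ⬝ᵥ x = S.card := by simp [dotProduct, hx]
  have hx1 : one ⬝ᵥ x = S.card := by simp [dotProduct, hx, hone]
  have hcut : x ⬝ᵥ A.mulVec x = k * S.card - ∑ x ∈ S, ∑ y ∈ Sᶜ, A x y := by
    have h1 : x ⬝ᵥ A.mulVec x = ∑ v ∈ S, ∑ w ∈ S, A v w := by
      simp [dotProduct, Matrix.mulVec, hx]
    have h2 : ∑ v ∈ S, ∑ w, A v w = k * S.card := by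
      have : ∀ v, ∑ w, A v w = k := by
        intro v
        have := congrFun hA1 v
        simpa [Matrix.mulVec, dotProduct, hone] using this
      simp [this, mul_comm]
    rw [h1, ← h2, ← Finset.sum_sub_distrib]
    refine Finset.sum_congr rfl fun v _ => ?_
    rw [← Finset.sum_add_sum_compl S]
    ring
  set a : V → ℝ := fun i => (b i).ofLp ⬝ᵥ x with ha
  have hquad : x ⬝ᵥ A.mulVec x = ∑ i, hA.eigenvalues i * (a i * a i) := by
    rw [hparseval]
    refine Finset.sum_congr rfl fun i _ => ?_
    rw [hmv]; ring
  have hnorm : (S.card : ℝ) = ∑ i, a i * a i := by rw [← hxx, hparseval]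
  -- The quadratic form of the indicator vector of `S` is split into its component along `b o`, with
  -- eigenvalue `k`, and the rest, where `lam` bounds the eigenvalues. The first component has
  -- square `|S|² / |V|`.
  have hbound : x ⬝ᵥ A.mulVec x - lam * S.card ≤ (k - lam) * (a o * a o) := by
    rw [hquad, hnorm, Finset.mul_sum, ← Finset.sum_sub_distrib,
      ← Finset.add_sum_erase _ _ (Finset.mem_univ o), hlamo]
    have : ∑ i ∈ univ.erase o, (hA.eigenvalues i * (a i * a i) - lam * (a i * a i)) ≤ 0 := by
      apply Finset.sum_nonpos
      intro i hi
      rw [← sub_mul]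
      exact mul_nonpos_of_nonpos_of_nonneg
        (sub_nonpos.mpr (hle i (Finset.ne_of_mem_erase hi))) (mul_self_nonneg _)
    linarith
  have hao : (S.card : ℝ) = α * a o := by rw [← hx1, hsum1]
  have hfin : (S.card : ℝ) * S.card = Fintype.card V * (a o * a o) := by
    rw [← hα2, hao]; ring
  rw [hcut] at hbound
  have hn : (0 : ℝ) ≤ Fintype.card V := Nat.cast_nonneg _
  have := mul_le_mul_of_nonneg_left hbound hn
  nlinarith [this, hfin]

end SimpleGraph

/-! ### Separators of the blow-up -/

/-- The index of the line through a point of the grid that is perpendicular to the side `k`,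
counted clockwise along this side. -/
def gridLine {δ : ℕ} (k : Fin 4) (q : Fin δ × Fin δ) : Fin δ :=
  match k with
  | 0 => q.1
  | 1 => q.2.rev
  | 2 => q.1.rev
  | 3 => q.2

theorem gridLine_gridSegment {δ : ℕ} (k : Fin 4) (i : Fin δ) :
    gridLine k (gridSegment k i) = i := by
  fin_cases k <;> simp [gridLine, gridSegment]

theorem Fin.eq_of_forall_adj_eq {δ : ℕ} {K : Type*} (f : Fin δ → K)
    (h : ∀ i j : Fin δ, (SimpleGraph.pathGraph δ).Adj i j → f i = f j) (i j : Fin δ) :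
    f i = f j := by
  have key : ∀ n (hn : n < δ), f ⟨n, hn⟩ = f ⟨0, by omega⟩ := by
    intro n
    induction n with
    | zero => intro _; rfl
    | succ n ih =>
      intro hn
      rw [← ih (by omega)]
      exact h _ _ (SimpleGraph.pathGraph_adj.mpr (Or.inr rfl))
  rw [key i i.isLt, key j j.isLt]

namespace RotationSystem.SideChoice

open Finset SimpleGraph

variable {V : Type u} {G : SimpleGraph V} {R : RotationSystem G}

theorem blowUp_adj_grid (σ : R.SideChoice) {δ : ℕ} (v : V) {p q : Fin δ × Fin δ}
    (h : ((pathGraph δ).boxProd (pathGraph δ)).Adj p q) :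
    (σ.blowUp δ).Adj (v, p) (v, q) := Or.inl ⟨rfl, h⟩

theorem blowUp_adj_segment (σ : R.SideChoice) {δ : ℕ} (d : G.Dart) (i : Fin δ) :
    (σ.blowUp δ).Adj (d.fst, gridSegment (σ.side d) i) (d.snd, gridSegment (σ.side d.symm) i.rev) :=
  Or.inr ⟨d, rfl, rfl, i, rfl, rfl⟩

/-- A set that is small compared with `δ` leaves many lines of a grid untouched, and
these lie in one component of the rest. -/
theorem exists_common_label [DecidableEq V] (σ : R.SideChoice) {δ : ℕ} {K : Type*}
    (X : Finset (V × (Fin δ × Fin δ))) (lab : V × (Fin δ × Fin δ) → K)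
    (hlab : ∀ x y, (σ.blowUp δ).Adj x y → x ∉ X → y ∉ X → lab x = lab y) (u : V)
    (hcol : ∃ i : Fin δ, ∀ j, (u, (i, j)) ∉ X) (hrow : ∃ j : Fin δ, ∀ i, (u, (i, j)) ∉ X) :
    ∃ b : K, ∀ (k : Fin 4) (i : Fin δ), (∀ q, gridLine k q = i → (u, q) ∉ X) →
      ∀ q, gridLine k q = i → lab (u, q) = b := by
  obtain ⟨c, hc⟩ := hcol
  obtain ⟨r, hr⟩ := hrow
  have col : ∀ i : Fin δ, (∀ j, (u, (i, j)) ∉ X) → ∀ j j', lab (u, (i, j)) = lab (u, (i, j')) := by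
    intro i hi
    refine Fin.eq_of_forall_adj_eq (fun j => lab (u, (i, j))) fun j j' h => ?_
    exact hlab _ _ (σ.blowUp_adj_grid u (boxProd_adj.mpr (Or.inr ⟨h, rfl⟩))) (hi _) (hi _)
  have row : ∀ j : Fin δ, (∀ i, (u, (i, j)) ∉ X) → ∀ i i', lab (u, (i, j)) = lab (u, (i', j)) := by
    intro j hj
    refine Fin.eq_of_forall_adj_eq (fun i => lab (u, (i, j))) fun i i' h => ?_
    exact hlab _ _ (σ.blowUp_adj_grid u (boxProd_adj.mpr (Or.inl ⟨h, rfl⟩))) (hj _) (hj _)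
  -- Every free column crosses the free row `r`, and every free row the free column `c`; so the
  -- label at `(c, r)` is common to all.
  have hcol' : ∀ i : Fin δ, (∀ j, (u, (i, j)) ∉ X) → ∀ j, lab (u, (i, j)) = lab (u, (c, r)) :=
    fun i hi j => (col i hi j r).trans (row r hr i c)
  have hrow' : ∀ j : Fin δ, (∀ i, (u, (i, j)) ∉ X) → ∀ i, lab (u, (i, j)) = lab (u, (c, r)) :=
    fun j hj i => (row j hj i c).trans (col c hc j r)
  refine ⟨lab (u, (c, r)), ?_⟩
  rintro k i hi ⟨a, b⟩ rfl
  fin_cases k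
  · exact hcol' a (fun j => hi (a, j) rfl) b
  · exact hrow' b (fun j => hi (j, b) rfl) a
  · exact hcol' a (fun j => hi (a, j) rfl) b
  · exact hrow' b (fun j => hi (j, b) rfl) a

/-- The lines perpendicular to one side are disjoint, so each vertex of `X` in the grid spoils at
most one of them. -/
theorem le_card_free_add [DecidableEq V] {δ : ℕ} (X : Finset (V × (Fin δ × Fin δ))) (u : V)
    (k : Fin 4) :
    δ ≤ (univ.filter fun i : Fin δ => ∀ q, gridLine k q = i → (u, q) ∉ X).card +
      (X.filter fun x => x.1 = u).card := by
  classical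
  have h1 : (univ.filter fun i : Fin δ => ¬ ∀ q, gridLine k q = i → (u, q) ∉ X) ⊆
      (X.filter fun x => x.1 = u).image fun x => gridLine k x.2 := by
    intro i hi
    simp only [mem_filter, mem_univ, true_and, not_forall, not_not] at hi
    obtain ⟨q, hq, hX⟩ := hi
    exact mem_image.mpr ⟨(u, q), by simp [hX], hq⟩
  have h2 := (card_le_card h1).trans card_image_le
  have h3 := card_filter_add_card_filter_not (s := (univ : Finset (Fin δ)))
    (fun i : Fin δ => ∀ q, gridLine k q = i → (u, q) ∉ X)
  rw [card_univ, Fintype.card_fin] at h3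
  omega

/-- A balanced separator of the blow-up of an expander is large. -/
theorem mul_card_le_of_balanced [Fintype V] [DecidableEq V] [DecidableRel G.Adj]
    (σ : R.SideChoice) {δ m : ℕ} (hδ : 1 ≤ δ) (hG : G.IsRegularOfDegree 4)
    (hV : 1 < Fintype.card V) {c : ℝ} (hc : c < 1) (hlam : G.secondEigenvalue / 4 < c)
    (X : Finset (V × (Fin δ × Fin δ))) (lab : V × (Fin δ × Fin δ) → Fin m)
    (hlab : ∀ x y, (σ.blowUp δ).Adj x y → x ∉ X → y ∉ X → lab x = lab y)
    (hbal : ∀ k, 2 * (univ.filter fun x => x ∉ X ∧ lab x = k).card ≤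
      Fintype.card (V × (Fin δ × Fin δ))) :
    (2 / 5 * (1 - c)) * (δ * Fintype.card V) ≤ (1 + 2 / 5 * (1 - c)) * (16 * X.card) := by
  classical
  set x : V → ℕ := fun u => (X.filter fun p => p.1 = u).card with hx
  let L : V → Fin 4 → Finset (Fin δ) := fun u k =>
    univ.filter fun i : Fin δ => ∀ q, gridLine k q = i → (u, q) ∉ X
  have hL : ∀ u k, δ ≤ (L u k).card + x u := fun u k => le_card_free_add X u k
  -- In a good grid more than `15 / 16` of the lines in either direction avoid `X`. This is enough
  -- both to match lines across an edge and to cover more than half of a grid by crossings of free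
  -- lines.
  set good : Finset V := univ.filter fun u => 16 * x u < δ with hgood
  have hmem : ∀ u, u ∈ good ↔ 16 * x u < δ := fun u => by simp [hgood]
  have hb : ∀ u, ∃ b : Fin m, u ∈ good → ∀ (k : Fin 4) (i : Fin δ), i ∈ L u k →
      ∀ q, gridLine k q = i → lab (u, q) = b := by
    intro u
    by_cases hu : u ∈ good
    · have hu' := (hmem u).mp hu
      have hne : ∀ k, (L u k).Nonempty := fun k => card_pos.mp (by have := hL u k; omega)
      obtain ⟨i, hi⟩ := hne 0
      obtain ⟨j, hj⟩ := hne 3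
      simp only [L, mem_filter, mem_univ, true_and] at hi hj
      obtain ⟨b, hb⟩ := σ.exists_common_label X lab hlab u ⟨i, fun j => hi _ rfl⟩
        ⟨j, fun i => hj _ rfl⟩
      exact ⟨b, fun _ k i hi => hb k i (by simpa [L] using hi)⟩
    · obtain ⟨i⟩ : Nonempty (Fin δ) := ⟨⟨0, by omega⟩⟩
      exact ⟨lab (u, (i, i)), fun h => absurd h hu⟩
  choose b hb using hb
  have hadj : ∀ u v, u ∈ good → v ∈ good → G.Adj u v → b u = b v := by
    intro u v hu hv huv
    let d : G.Dart := ⟨(u, v), huv⟩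
    have hu' := (hmem u).mp hu
    have hv' := (hmem v).mp hv
    -- Both sets contain more than half of the `δ` indices; `Fin.rev` is the matching of the
    -- parallel edges.
    have : ¬ Disjoint (L u (σ.side d)) ((L v (σ.side d.symm)).image Fin.rev) := by
      intro hd
      have h1 := card_union_of_disjoint hd
      have h2 := card_le_univ (L u (σ.side d) ∪ (L v (σ.side d.symm)).image Fin.rev)
      rw [Fintype.card_fin] at h2
      rw [card_image_of_injective _ Fin.rev_injective] at h1
      have := hL u (σ.side d)
      have := hL v (σ.side d.symm)
      omega
    rw [not_disjoint_iff] at this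
    obtain ⟨i, hi, hi'⟩ := this
    obtain ⟨j, hj, rfl⟩ := mem_image.mp hi'
    have h1 := hb u hu _ _ hi _ (gridLine_gridSegment _ _)
    have h2 := hb v hv _ _ hj _ (gridLine_gridSegment _ _)
    rw [← h1, ← h2]
    have h3 := σ.blowUp_adj_segment d j.rev
    rw [Fin.rev_rev] at h3
    refine hlab _ _ h3 ?_ ?_
    · exact (mem_filter.mp hi).2 _ (gridLine_gridSegment _ _)
    · exact (mem_filter.mp hj).2 _ (gridLine_gridSegment _ _)
  set n := Fintype.card V with hn
  let S : Fin m → Finset V := fun k => good.filter fun u => b u = k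
  -- The crossings of free columns and rows give each vertex of `S k` at least `(15 / 16)² δ²`
  -- vertices labelled `k`, while balance allows at most half of `δ² n`. Here `225 = 15²` and `128 =
  -- 16² / 2`.
  have hS : ∀ k, 225 * (S k).card ≤ 128 * n := by
    intro k
    have h1 : ((S k).sigma fun u => L u 0 ×ˢ L u 3).card ≤
        (univ.filter fun x => x ∉ X ∧ lab x = k).card := by
      refine card_le_card_of_injOn (fun p => (p.1, p.2)) ?_ ?_
      · rintro ⟨u, i, j⟩ h
        simp only [S, coe_sigma, Set.mem_sigma_iff, mem_coe, mem_filter, mem_product] at h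
        simp only [coe_filter, mem_univ, true_and, Set.mem_ofPred_eq]
        refine ⟨(mem_filter.mp h.2.1).2 _ rfl, ?_⟩
        rw [← h.1.2]
        exact hb u h.1.1 0 i h.2.1 _ rfl
      · rintro ⟨u, q⟩ _ ⟨u', q'⟩ _ h
        simp only [Prod.mk.injEq] at h
        obtain ⟨rfl, rfl⟩ := h
        rfl
    rw [card_sigma] at h1
    have h2 : (S k).card * (225 * δ ^ 2) ≤ ∑ u ∈ S k, 256 * (L u 0 ×ˢ L u 3).card := by
      rw [← smul_eq_mul, ← sum_const]
      refine sum_le_sum fun u hu => ?_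
      have hu' := (hmem u).mp (mem_filter.mp hu).1
      have h0 := hL u 0
      have h3 := hL u 3
      rw [card_product]
      have h0' : 15 * δ ≤ 16 * (L u 0).card := by omega
      have h3' : 15 * δ ≤ 16 * (L u 3).card := by omega
      have := Nat.mul_le_mul h0' h3'
      nlinarith
    rw [← mul_sum] at h2
    have h3 := hbal k
    rw [Fintype.card_prod, Fintype.card_prod, Fintype.card_fin] at h3
    have h4 : δ ^ 2 * (225 * (S k).card) ≤ δ ^ 2 * (128 * n) := by nlinarith
    exact Nat.le_of_mul_le_mul_left h4 (by positivity)
  have hlam4 : G.secondEigenvalue < (4 : ℕ) := by push_cast; linarith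
  have hnpos : (0 : ℝ) < n := by exact_mod_cast (by omega : 0 < n)
  set bad : Finset V := goodᶜ with hbad
  -- A good neighbour of a vertex of `S k` has the same label, so the cut around `S k` runs into
  -- `bad` only. The factor `2 / 5` is a lower bound for the share `97 / 225` left outside `S k`.
  have hcut : ∀ k, 4 * (2 / 5 * (1 - c)) * (S k).card ≤
      ∑ u ∈ S k, ∑ v ∈ bad, G.adjMatrix ℝ u v := by
    intro k
    have h1 := hG.secondEigenvalue_mul_card_le hV hlam4 (S k)
    have h2 : ∑ u ∈ S k, ∑ v ∈ (S k)ᶜ, G.adjMatrix ℝ u v =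
        ∑ u ∈ S k, ∑ v ∈ bad, G.adjMatrix ℝ u v := by
      refine sum_congr rfl fun u hu => ?_
      symm
      apply sum_subset
      · intro v hv
        rw [hbad, mem_compl] at hv
        rw [mem_compl]
        exact fun h => hv (mem_filter.mp h).1
      · intro v hv hv'
        rw [hbad, mem_compl, not_not] at hv'
        rw [adjMatrix_apply, if_neg]
        intro hadj'
        rw [mem_compl] at hv
        exact hv (mem_filter.mpr ⟨hv', by
          rw [← hadj u v (mem_filter.mp hu).1 hv' hadj']; exact (mem_filter.mp hu).2⟩)
    rw [h2] at h1
    have h3 : (225 : ℝ) * (S k).card ≤ 128 * n := by exact_mod_cast hS k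
    have h4 : (2 / 5 : ℝ) * n ≤ n - (S k).card := by linarith
    have h5 : (0 : ℝ) ≤ (S k).card := Nat.cast_nonneg _
    have h6 : 4 * (1 - c) ≤ ((4 : ℕ) : ℝ) - G.secondEigenvalue := by push_cast; linarith
    have h7 : 4 * (1 - c) * ((S k).card * (2 / 5 * n)) ≤
        (((4 : ℕ) : ℝ) - G.secondEigenvalue) * ((S k).card * (n - (S k).card)) :=
      mul_le_mul h6 (mul_le_mul_of_nonneg_left h4 h5) (by positivity) (by linarith)
    have h8 := h7.trans h1
    refine le_of_mul_le_mul_left ?_ hnpos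
    linarith
  -- The sets `S k` partition `good`, and at most four edges end in each bad vertex.
  have hsum : 4 * (2 / 5 * (1 - c)) * good.card ≤ 4 * bad.card := by
    have h1 := sum_le_sum fun k (_ : k ∈ (univ : Finset (Fin m))) => hcut k
    rw [← mul_sum] at h1
    have h2 : ∑ k, ((S k).card : ℝ) = good.card := by
      rw [← Nat.cast_sum]
      congr 1
      exact (card_eq_sum_card_fiberwise fun u _ => mem_univ (b u)).symm
    have h3 : ∑ k, ∑ u ∈ S k, ∑ v ∈ bad, G.adjMatrix ℝ u v =
        ∑ u ∈ good, ∑ v ∈ bad, G.adjMatrix ℝ u v :=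
      sum_fiberwise good b _
    have h4 : ∑ u ∈ good, ∑ v ∈ bad, G.adjMatrix ℝ u v ≤ 4 * bad.card := by
      refine (Finset.sum_comm).trans_le ?_
      have : ∀ v ∈ bad, ∑ u ∈ good, G.adjMatrix ℝ u v ≤ 4 := by
        intro v _
        have h5 : ∑ u, G.adjMatrix ℝ u v = 4 := by
          have := hG v
          simp only [adjMatrix_apply, G.adj_comm _ v]
          rw [sum_boole]
          rw [← card_neighborFinset_eq_degree, neighborFinset_eq_filter] at this
          rw [this]; norm_num
        rw [← h5]
        refine sum_le_sum_of_subset_of_nonneg (subset_univ _) fun i _ _ => ?_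
        rw [adjMatrix_apply]; split_ifs <;> norm_num
      refine (sum_le_sum this).trans ?_
      simp [mul_comm]
    rw [h2, h3] at h1
    exact h1.trans h4
  have hgb : (good.card : ℝ) + bad.card = n := by
    exact_mod_cast card_add_card_compl good
  have hX : δ * bad.card ≤ 16 * X.card := by
    have h1 : X.card = ∑ u, x u := card_eq_sum_card_fiberwise fun p _ => mem_univ p.1
    have h2 : ∑ u ∈ bad, x u ≤ X.card := by
      rw [h1]; exact sum_le_sum_of_subset (subset_univ _)
    have h3 : bad.card * δ ≤ ∑ u ∈ bad, 16 * x u := by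
      rw [← smul_eq_mul, ← sum_const]
      refine sum_le_sum fun u hu => ?_
      rw [hbad, mem_compl, hmem] at hu
      omega
    rw [← mul_sum] at h3
    nlinarith
  have hX' : (δ : ℝ) * bad.card ≤ 16 * X.card := by exact_mod_cast hX
  have hδ' : (0 : ℝ) ≤ δ := Nat.cast_nonneg _
  have h1 : 2 / 5 * (1 - c) * n ≤ (1 + 2 / 5 * (1 - c)) * bad.card := by
    rw [← hgb]; linarith
  calc 2 / 5 * (1 - c) * (δ * n) = δ * (2 / 5 * (1 - c) * n) := by ring
    _ ≤ δ * ((1 + 2 / 5 * (1 - c)) * bad.card) := mul_le_mul_of_nonneg_left h1 hδ'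
    _ = (1 + 2 / 5 * (1 - c)) * (δ * bad.card) := by ring
    _ ≤ _ := mul_le_mul_of_nonneg_left hX' (by linarith)

theorem le_treewidth_blowUp [Fintype V] [DecidableEq V] [DecidableRel G.Adj] [Nonempty V]
    (σ : R.SideChoice) {δ : ℕ} (hδ : 1 ≤ δ) (hG : G.IsRegularOfDegree 4)
    {c : ℝ} (hc : c < 1) (hlam : G.secondEigenvalue / 4 < c) :
    (2 / 5 * (1 - c)) / (32 * (1 + 2 / 5 * (1 - c))) * δ * Fintype.card V ≤
      (σ.blowUp δ).treewidth := by
  obtain ⟨v⟩ := ‹Nonempty V›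
  obtain ⟨w, hw⟩ : ∃ w, G.Adj v w := by
    have h : 0 < G.degree v := by rw [hG v]; norm_num
    exact (G.degree_pos_iff_exists_adj v).mp h
  have hV : 1 < Fintype.card V := Fintype.one_lt_card_iff.mpr ⟨v, w, hw.ne⟩
  have h1 := one_le_treewidth (σ.blowUp_adj_segment ⟨(v, w), hw⟩ (⟨0, hδ⟩ : Fin δ))
  obtain ⟨m, D, hD⟩ := (σ.blowUp δ).exists_treeDecomposition_treewidth
  obtain ⟨t, lab, hlab, hbal⟩ := D.exists_balanced
  have h2 := σ.mul_card_le_of_balanced hδ hG hV hc hlam (D.bag t) lab hlab hbal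
  have h3 : (D.bag t).card ≤ 2 * (σ.blowUp δ).treewidth := by
    have := hD t; omega
  have h4 : ((D.bag t).card : ℝ) ≤ 2 * (σ.blowUp δ).treewidth := by exact_mod_cast h3
  have ha : 0 < 1 + 2 / 5 * (1 - c) := by linarith
  rw [mul_assoc, div_mul_eq_mul_div, div_le_iff₀ (by positivity)]
  refine h2.trans ?_
  have := mul_le_mul_of_nonneg_left h4 ha.le
  linarith

end RotationSystem.SideChoice

/-! ### Quarter turns and the square of a vertex -/

open Complex in
/-- The rotation of the plane by `k` right angles. -/
noncomputable def quarter (k : Fin 4) : ℂ := I ^ (k : ℕ)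

namespace quarter

open Complex

theorem add (k l : Fin 4) : quarter (k + l) = quarter k * quarter l := by
  rw [quarter, quarter, quarter, Fin.val_add, ← Complex.I_pow_eq_pow_mod, pow_add]

theorem zero : quarter 0 = 1 := by simp [quarter]

theorem one : quarter 1 = I := by simp [quarter]

theorem neg_mul_self (k : Fin 4) : quarter (-k) * quarter k = 1 := by
  rw [← add, neg_add_cancel, zero]

theorem mul_neg_self (k : Fin 4) : quarter k * quarter (-k) = 1 := by
  rw [mul_comm, neg_mul_self]

theorem neg_one : quarter (-1) = -I := by
  have h := neg_mul_self 1
  rw [one] at h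
  linear_combination (-I) * h + quarter (-1) * (I_mul_I)

theorem cases (k : Fin 4) : quarter k = 1 ∨ quarter k = I ∨ quarter k = -1 ∨ quarter k = -I := by
  fin_cases k
  · exact Or.inl (by simp [quarter])
  · exact Or.inr (Or.inl (by simp [quarter]))
  · exact Or.inr (Or.inr (Or.inl (by simp [quarter])))
  · exact Or.inr (Or.inr (Or.inr (by simp [quarter, I_pow_three])))

theorem neg_mul_cancel (k : Fin 4) (z : ℂ) : quarter (-k) * (quarter k * z) = z := by
  rw [← mul_assoc, neg_mul_self, one_mul]

theorem mul_neg_cancel (k : Fin 4) (z : ℂ) : quarter k * (quarter (-k) * z) = z := by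
  rw [← mul_assoc, mul_neg_self, one_mul]

theorem injective (k : Fin 4) {z z' : ℂ} (h : quarter k * z = quarter k * z') : z = z' := by
  rw [← neg_mul_cancel k z, h, neg_mul_cancel]

end quarter

/-- The square in which a vertex of a four-regular graph is drawn. -/
def vertexSquare : Set ℂ := {z | |z.re| ≤ 1 ∧ |z.im| ≤ 1}

theorem quarter_mul_mem_vertexSquare (k : Fin 4) {z : ℂ} (hz : z ∈ vertexSquare) :
    quarter k * z ∈ vertexSquare := by
  obtain ⟨h1, h2⟩ := hz
  rcases quarter.cases k with h | h | h | h <;> rw [h] <;> simp [vertexSquare, h1, h2]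

/-- Quadrant `k` is the first quadrant turned `k` times; the quadrants become the four corners at a
vertex. -/
theorem exists_eq_quarter_mul {z : ℂ} (hz : z ∈ vertexSquare) :
    ∃ (k : Fin 4) (x y : unitInterval), z = quarter k * ((x : ℝ) + (y : ℝ) * Complex.I) := by
  obtain ⟨h1, h2⟩ := hz
  rw [abs_le] at h1 h2
  have q2 : quarter 2 = -1 := by simp [quarter]
  have q3 : quarter 3 = -Complex.I := by simp [quarter, Complex.I_pow_three]
  by_cases hx : 0 ≤ z.re <;> by_cases hy : 0 ≤ z.im
  · refine ⟨0, ⟨z.re, hx, h1.2⟩, ⟨z.im, hy, h2.2⟩, ?_⟩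
    rw [quarter.zero]; apply Complex.ext <;> simp
  · refine ⟨3, ⟨-z.im, by linarith, by linarith⟩, ⟨z.re, hx, h1.2⟩, ?_⟩
    rw [q3]; apply Complex.ext <;> simp
  · refine ⟨1, ⟨z.im, hy, h2.2⟩, ⟨-z.re, by linarith, by linarith⟩, ?_⟩
    rw [quarter.one]; apply Complex.ext <;> simp
  · refine ⟨2, ⟨-z.re, by linarith, by linarith⟩, ⟨-z.im, by linarith, by linarith⟩, ?_⟩
    rw [q2]; apply Complex.ext <;> simp

/-! ### Collapsing the outside of two adjacent squares -/

/-- The union of two adjacent squares. -/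
def doubleSquare : Set ℂ := {w | |w.re| < 2 ∧ |w.im| < 1}

/-- A function that is positive on `doubleSquare` and vanishes elsewhere. -/
noncomputable def bump (w : ℂ) : ℝ := max 0 (2 - |w.re|) * max 0 (1 - |w.im|)

theorem continuous_bump : Continuous bump := by unfold bump; fun_prop

theorem bump_pos_iff {w : ℂ} : 0 < bump w ↔ w ∈ doubleSquare := by
  unfold bump doubleSquare
  constructor
  · intro h
    by_contra hc
    rw [Set.mem_ofPred_eq, not_and_or, not_lt, not_lt] at hc
    rcases hc with hc | hc
    · rw [max_eq_left (by linarith : 2 - |w.re| ≤ 0)] at h; simp at h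
    · rw [max_eq_left (by linarith : 1 - |w.im| ≤ 0)] at h; simp at h
  · rintro ⟨h1, h2⟩
    exact mul_pos (lt_max_of_lt_right (by linarith)) (lt_max_of_lt_right (by linarith))

theorem bump_nonneg (w : ℂ) : 0 ≤ bump w := mul_nonneg (le_max_left _ _) (le_max_left _ _)

theorem bump_eq_zero {w : ℂ} (h : w ∉ doubleSquare) : bump w = 0 :=
  le_antisymm (not_lt.mp fun h' => h (bump_pos_iff.mp h')) (bump_nonneg w)

/-- The plane with the complement of `doubleSquare` collapsed to a point. -/
noncomputable def collapse (w : ℂ) : ℂ × ℝ := (bump w • w, bump w)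

theorem continuous_collapse : Continuous collapse :=
  (continuous_bump.smul continuous_id).prodMk continuous_bump

theorem collapse_eq_zero {w : ℂ} (h : w ∉ doubleSquare) : collapse w = 0 := by
  simp [collapse, bump_eq_zero h]

/-- The second component recovers the nonzero factor by which the point was scaled. The point `w'`
needs no hypothesis, since its factor is the same. -/
theorem collapse_injOn {w w' : ℂ} (hw : w ∈ doubleSquare) (h : collapse w = collapse w') :
    w = w' := by
  simp only [collapse, Prod.mk.injEq] at h
  have h1 : bump w ≠ 0 := (bump_pos_iff.mpr hw).ne'
  rw [← h.2] at h
  exact smul_right_injective ℂ h1 h.1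

theorem collapse_ne_zero {w : ℂ} (hw : w ∈ doubleSquare) : collapse w ≠ 0 := fun h =>
  (bump_pos_iff.mpr hw).ne' (congrArg Prod.snd h)

/-! ### The surface as a union of squares, one for each vertex -/

namespace RotationSystem.SideChoice

open SimpleGraph Complex

variable {V : Type u} {G : SimpleGraph V} {R : RotationSystem G} (σ : R.SideChoice)

/-- The four half-edges at every vertex have different sides. -/
theorem bijective_fst_side [Fintype V] [DecidableEq V] [DecidableRel G.Adj]
    (hG : G.IsRegularOfDegree 4) :
    Function.Bijective fun d : G.Dart => (d.fst, σ.side d) := by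
  classical
  have hsurj : Function.Surjective fun d : G.Dart => (d.fst, σ.side d) := by
    rintro ⟨v, k⟩
    obtain ⟨w, hw⟩ : ∃ w, G.Adj v w := by
      have h : 0 < G.degree v := by rw [hG v]; norm_num
      exact (G.degree_pos_iff_exists_adj v).mp h
    let d : G.Dart := ⟨(v, w), hw⟩
    -- Each step of the rotation raises the side by one, so every side occurs at `v`; injectivity
    -- follows by counting the `4 |V|` darts.
    have h1 : ∀ n : ℕ, ((R.next ^ n) d).fst = v ∧ σ.side ((R.next ^ n) d) = σ.side d + Fin.ofNat 4 n := by
      intro n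
      induction n with
      | zero => exact ⟨rfl, by simp⟩
      | succ n ih =>
        rw [pow_succ', Equiv.Perm.mul_apply, R.next_fst, σ.side_next, ih.2]
        refine ⟨ih.1, ?_⟩
        rw [add_assoc]
        congr 1
        ext
        simp [Fin.val_add]
    refine ⟨(R.next ^ (k - σ.side d).val) d, ?_⟩
    simp only [Prod.mk.injEq]
    refine ⟨(h1 _).1, (h1 _).2.trans ?_⟩
    simp
  refine (Fintype.bijective_iff_surjective_and_card _).mpr ⟨hsurj, ?_⟩
  rw [G.dart_card_eq_sum_degrees, Fintype.card_prod, Fintype.card_fin, Finset.sum_congr rfl fun v _ => hG v]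
  simp

/-- The position of a point of a corner in the square of its vertex. -/
noncomputable def pos (c : R.Corners) : ℂ :=
  quarter (σ.side c.1) * ((c.2.1 : ℝ) + (c.2.2 : ℝ) * I)

theorem pos_mem (c : R.Corners) : σ.pos c ∈ vertexSquare := by
  apply quarter_mul_mem_vertexSquare
  obtain ⟨d, x, y⟩ := c
  simp only [vertexSquare, Set.mem_ofPred_eq]
  simp [abs_of_nonneg x.2.1, abs_of_nonneg y.2.1, x.2.2, y.2.2]

section

variable (hσ : Function.Bijective fun d : G.Dart => (d.fst, σ.side d))

include hσ

/-- Two different quadrants meet in a half-axis if they are consecutive, which is the `halfEdge`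
gluing, and in the centre alone if they are opposite, where two such gluings are composed. Thus the
square of a vertex maps to the surface without ambiguity. -/
theorem mk_eq_of_pos_eq {c c' : R.Corners} (hv : c.1.fst = c'.1.fst) (h : σ.pos c = σ.pos c') :
    Quot.mk R.Glue c = Quot.mk R.Glue c' := by
  have hz : ∀ x : unitInterval, (x : ℝ) ≤ 0 → x = 0 := fun x h =>
    Subtype.ext (le_antisymm h x.2.1)
  have key : ∀ (d d' : G.Dart) (x y x' y' : unitInterval), d.fst = d'.fst →
      ((x : ℝ) : ℂ) + (y : ℝ) * I = I * ((x' : ℝ) + (y' : ℝ) * I) → σ.side d' = σ.side d + 1 →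
      Quot.mk R.Glue ⟨d, (x, y)⟩ = Quot.mk R.Glue ⟨d', (x', y')⟩ := by
    intro d d' x y x' y' hd he hs
    have hre := congrArg Complex.re he
    have him := congrArg Complex.im he
    simp at hre him
    have hx := x.2.1
    have hy' := y'.2.1
    have hx0 : x = 0 := hz _ (by linarith)
    have hy0 : y' = 0 := hz _ (by linarith)
    have hyx : y = x' := Subtype.ext him
    have hdd : d' = R.next d := by
      apply hσ.1
      simp only [Prod.mk.injEq]
      exact ⟨by rw [R.next_fst, hd], by rw [σ.side_next, hs]⟩
    subst hx0 hy0 hyx hdd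
    exact Quot.sound (Glue.halfEdge d y)
  obtain ⟨d, x, y⟩ := c
  obtain ⟨d', x', y'⟩ := c'
  simp only [pos] at h
  simp only at hv
  obtain ⟨k, hk⟩ : ∃ k, σ.side d' = σ.side d + k := ⟨σ.side d' - σ.side d, (add_sub_cancel _ _).symm⟩
  have h' : ((x : ℝ) : ℂ) + (y : ℝ) * I = quarter k * ((x' : ℝ) + (y' : ℝ) * I) := by
    apply quarter.injective (σ.side d)
    rw [h, hk, quarter.add, mul_assoc]
  fin_cases k
  · have hdd : d = d' := hσ.1 (by simp only [Prod.mk.injEq]; exact ⟨hv, by simpa using hk.symm⟩)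
    subst hdd
    simp only [Fin.zero_eta, quarter.zero, one_mul] at h'
    have hre := congrArg Complex.re h'
    have him := congrArg Complex.im h'
    simp at hre him
    rw [Subtype.ext hre, Subtype.ext him]
  · exact key d d' x y x' y' hv (by simpa [quarter.one] using h') hk
  · have hq : quarter 2 = -1 := by simp [quarter]
    simp only [Fin.reduceFinMk, hq] at h'
    have hre := congrArg Complex.re h'
    have him := congrArg Complex.im h'
    simp at hre him
    have := x.2.1
    have := y.2.1
    have := x'.2.1
    have := y'.2.1
    have hx : x = 0 := hz _ (by linarith)
    have hy : y = 0 := hz _ (by linarith)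
    have hx' : x' = 0 := hz _ (by linarith)
    have hy' : y' = 0 := hz _ (by linarith)
    subst hx hy hx' hy'
    rw [key d (R.next d) 0 0 0 0 (R.next_fst d).symm (by simp) (σ.side_next d)]
    refine key _ _ 0 0 0 0 (by rw [R.next_fst, hv]) (by simp) ?_
    rw [σ.side_next, hk, add_assoc]
    rfl
  · refine (key d' d x' y' x y hv.symm ?_ ?_).symm
    · have hq : quarter 3 = -I := by simp [quarter, I_pow_three]
      simp only [Fin.reduceFinMk, hq] at h'
      rw [h']
      linear_combination ((x' : ℝ) + (y' : ℝ) * I) * I_mul_I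
    · rw [hk, add_assoc]
      simp only [Fin.reduceFinMk, left_eq_add]
      rfl

theorem exists_corner (v : V) {z : ℂ} (hz : z ∈ vertexSquare) :
    ∃ c : R.Corners, c.1.fst = v ∧ σ.pos c = z := by
  obtain ⟨k, x, y, rfl⟩ := exists_eq_quarter_mul hz
  obtain ⟨d, hd⟩ := hσ.2 (v, k)
  simp only [Prod.mk.injEq] at hd
  exact ⟨⟨d, (x, y)⟩, hd.1, by simp only [pos]; rw [hd.2]⟩

open Classical in
omit hσ in
/-- The map that draws the square of a vertex on the surface; arbitrary outside the square. -/
noncomputable def square [Nonempty R.Surface] (v : V) (z : ℂ) : R.Surface :=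
  if h : ∃ c : R.Corners, c.1.fst = v ∧ σ.pos c = z then Quot.mk R.Glue h.choose
  else Classical.arbitrary _

variable [Nonempty R.Surface]

theorem mk_eq_square (c : R.Corners) : Quot.mk R.Glue c = σ.square c.1.fst (σ.pos c) := by
  have h : ∃ c' : R.Corners, c'.1.fst = c.1.fst ∧ σ.pos c' = σ.pos c := ⟨c, rfl, rfl⟩
  rw [square, dif_pos h]
  exact σ.mk_eq_of_pos_eq hσ h.choose_spec.1.symm h.choose_spec.2.symm

theorem exists_square_eq (p : R.Surface) : ∃ v, ∃ z ∈ vertexSquare, σ.square v z = p := by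
  obtain ⟨c, rfl⟩ := Quot.exists_rep p
  exact ⟨_, _, σ.pos_mem c, (σ.mk_eq_square hσ c).symm⟩

/-- This is the `face` gluing in the coordinates of the squares. The corner on the other side starts
one quarter turn before `d.symm`, and this turn moves its side `(t, 1)` onto the side of `d.symm`,
traversed in reverse. -/
theorem square_side_of_nonneg (d : G.Dart) {t : ℝ} (ht : 0 ≤ t) (ht' : t ≤ 1) :
    σ.square d.fst (quarter (σ.side d) * (1 + t * I)) =
      σ.square d.snd (quarter (σ.side d.symm) * (1 - t * I)) := by
  let τ : unitInterval := ⟨t, ht, ht'⟩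
  set e := R.next.symm d.symm with he
  have hne : R.next e = d.symm := by simp [he]
  have h := Quot.sound (Glue.face d e hne τ)
  rw [σ.mk_eq_square hσ, σ.mk_eq_square hσ] at h
  have h1 : σ.pos ⟨d, (1, τ)⟩ = quarter (σ.side d) * (1 + t * I) := by simp [pos, τ]
  have h2 : σ.pos ⟨e, (τ, 1)⟩ = quarter (σ.side d.symm) * (1 - t * I) := by
    have hs : σ.side e = σ.side d.symm + (-1) := by
      rw [← hne, σ.side_next, add_neg_cancel_right]
    simp only [pos]
    rw [hs, quarter.add, quarter.neg_one]
    simp only [Set.Icc.coe_one, ofReal_one, one_mul, τ]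
    linear_combination (-quarter (σ.side d.symm)) * I_mul_I
  have h3 : e.fst = d.snd := by rw [← R.next_fst e, hne]; rfl
  rw [h1, h2] at h
  simp only at h
  rw [h, h3]

/-- The other half of the common side is the same statement for the reversed dart. -/
theorem square_side (d : G.Dart) {t : ℝ} (ht : |t| ≤ 1) :
    σ.square d.fst (quarter (σ.side d) * (1 + t * I)) =
      σ.square d.snd (quarter (σ.side d.symm) * (1 - t * I)) := by
  rw [abs_le] at ht
  rcases le_total 0 t with h | h
  · exact σ.square_side_of_nonneg hσ d h ht.2
  · have := σ.square_side_of_nonneg hσ d.symm (t := -t) (by linarith) (by linarith)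
    simp only [Dart.symm_symm] at this
    push_cast at this
    simp only [neg_mul, sub_neg_eq_add, ← sub_eq_add_neg] at this
    exact this.symm

end

end RotationSystem.SideChoice

theorem neg_mem_doubleSquare {w : ℂ} : -w ∈ doubleSquare ↔ w ∈ doubleSquare := by
  simp [doubleSquare]

/-- The three sides of the square that do not belong to the dart fall outside the chart domain and
are collapsed; their gluings therefore impose no condition on the chart. -/
theorem one_sub_quarter_mul_notMem {k : Fin 4} (hk : k ≠ 0) (t : ℝ) :
    1 - quarter k * (1 + t * Complex.I) ∉ doubleSquare := by
  have q2 : quarter 2 = -1 := by simp [quarter]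
  have q3 : quarter 3 = -Complex.I := by simp [quarter, Complex.I_pow_three]
  rintro ⟨h1, h2⟩
  fin_cases k
  · exact hk rfl
  · simp [quarter.one] at h2
  · simp [q2] at h1
    norm_num at h1
  · simp [q3] at h2

theorem one_sub_mem_vertexSquare {w : ℂ} (hw : w ∈ doubleSquare) (h : 0 ≤ w.re) :
    1 - w ∈ vertexSquare := by
  obtain ⟨h1, h2⟩ := hw
  rw [abs_lt] at h1 h2
  simp only [vertexSquare, Set.mem_ofPred_eq, abs_le]
  simp
  refine ⟨⟨?_, ?_⟩, ?_, ?_⟩ <;> linarith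

theorem one_add_mem_vertexSquare {w : ℂ} (hw : w ∈ doubleSquare) (h : w.re ≤ 0) :
    1 + w ∈ vertexSquare := by
  have := one_sub_mem_vertexSquare (neg_mem_doubleSquare.mpr hw) (by simpa using h)
  rwa [sub_neg_eq_add] at this

/-! ### Charts from pairs of adjacent squares -/

namespace RotationSystem.SideChoice

open SimpleGraph Complex

variable {V : Type u} {G : SimpleGraph V} {R : RotationSystem G} (σ : R.SideChoice)

/-- The squares of the ends of the dart `d`, glued along their common side to `doubleSquare`,
give a chart of the surface, collapsed outside its domain. -/
noncomputable def squareChart (d : G.Dart) (v : V) (z : ℂ) : ℂ × ℝ :=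
  open Classical in
  if v = d.fst then collapse (1 - quarter (-σ.side d) * z)
  else if v = d.snd then collapse (-(1 - quarter (-σ.side d.symm) * z))
  else 0

theorem squareChart_fst {d : G.Dart} {v : V} (h : v = d.fst) (z : ℂ) :
    σ.squareChart d v z = collapse (1 - quarter (-σ.side d) * z) := if_pos h

theorem squareChart_snd {d : G.Dart} {v : V} (h : v = d.snd) (z : ℂ) :
    σ.squareChart d v z = collapse (-(1 - quarter (-σ.side d.symm) * z)) :=
  (if_neg fun h' => d.adj.ne (h'.symm.trans h)).trans (if_pos h)

theorem squareChart_of_ne {d : G.Dart} {v : V} (h : v ≠ d.fst) (h' : v ≠ d.snd) (z : ℂ) :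
    σ.squareChart d v z = 0 := (if_neg h).trans (if_neg h')

theorem continuous_squareChart (d : G.Dart) (v : V) : Continuous (σ.squareChart d v) := by
  have := continuous_collapse
  by_cases h : v = d.fst
  · rw [funext (σ.squareChart_fst h)]; fun_prop
  · by_cases h' : v = d.snd
    · rw [funext (σ.squareChart_snd h')]; fun_prop
    · rw [funext (σ.squareChart_of_ne h h')]; fun_prop

theorem continuous_squareChart_pos (d : G.Dart) :
    Continuous fun c : R.Corners => σ.squareChart d c.1.fst (σ.pos c) := by
  refine continuous_sigma fun e => ?_
  have h : Continuous fun a => σ.pos ⟨e, a⟩ := by unfold pos; fun_prop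
  exact (σ.continuous_squareChart d e.fst).comp h

section

variable (hσ : Function.Bijective fun d : G.Dart => (d.fst, σ.side d))

include hσ

/-- A `halfEdge` gluing does not change the position in the square. A `face` gluing takes place
along the side of one edge: if this is the edge of `d`, the two formulas agree up to the sign of
`t`; if not, both values are zero. As `G` is simple, the ends of a dart decide which case occurs. -/
theorem squareChart_eq_of_glue (d : G.Dart) {c c' : R.Corners} (h : R.Glue c c') :
    σ.squareChart d c.1.fst (σ.pos c) = σ.squareChart d c'.1.fst (σ.pos c') := by
  have hne := d.adj.ne
  cases h with
  | halfEdge d' t =>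
    have hp : σ.pos ⟨d', (0, t)⟩ = σ.pos ⟨R.next d', (t, 0)⟩ := by
      simp only [pos, σ.side_next, quarter.add, quarter.one]
      simp
      ring
    rw [hp]
    simp only [R.next_fst]
  | face d' e he t =>
    have hef : e.fst = d'.snd := by rw [← R.next_fst e, he]; rfl
    have hes : σ.side e = σ.side d'.symm + (-1) := by
      rw [← he, σ.side_next, add_neg_cancel_right]
    have hp : σ.pos ⟨d', (1, t)⟩ = quarter (σ.side d') * (1 + (t : ℝ) * I) := by simp [pos]
    have hp' : σ.pos ⟨e, (t, 1)⟩ = quarter (σ.side d'.symm) * (1 - (t : ℝ) * I) := by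
      simp only [pos, hes, quarter.add, quarter.neg_one, Set.Icc.coe_one, ofReal_one, one_mul]
      linear_combination (-quarter (σ.side d'.symm)) * I_mul_I
    have hdart : ∀ a b : G.Dart, a.fst = b.fst → a.snd = b.snd → a = b := fun a b h h' =>
      Dart.ext _ _ (Prod.ext h h')
    have hside : ∀ a b : G.Dart, a ≠ b → a.fst = b.fst → ∀ s : ℝ,
        1 - quarter (-σ.side b) * (quarter (σ.side a) * (1 + s * I)) ∉ doubleSquare := by
      intro a b hab hfst s
      rw [← mul_assoc, ← quarter.add]
      apply one_sub_quarter_mul_notMem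
      intro h
      apply hab
      apply hσ.1
      simp only [Prod.mk.injEq]
      refine ⟨hfst, ?_⟩
      rw [neg_add_eq_zero] at h
      exact h.symm
    have hside' : ∀ a b : G.Dart, a ≠ b → a.fst = b.fst → ∀ s : ℝ,
        1 - quarter (-σ.side b) * (quarter (σ.side a) * (1 - s * I)) ∉ doubleSquare := by
      intro a b hab hfst s
      have := hside a b hab hfst (-s)
      push_cast at this
      rwa [neg_mul, ← sub_eq_add_neg] at this
    rw [hp, hp']
    simp only [hef]
    have hne' := d'.adj.ne
    by_cases h1 : d'.fst = d.fst
    · have h2 : d'.snd ≠ d.fst := by rw [← h1]; exact hne'.symm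
      rw [σ.squareChart_fst h1]
      by_cases h3 : d' = d
      · subst h3
        rw [σ.squareChart_snd rfl, quarter.neg_mul_cancel, quarter.neg_mul_cancel]
        congr 1; ring
      · rw [σ.squareChart_of_ne h2 fun h => h3 (hdart _ _ h1 h),
          collapse_eq_zero (hside d' d h3 h1 _)]
    · by_cases h2 : d'.fst = d.snd
      · rw [σ.squareChart_snd h2]
        by_cases h3 : d'.symm = d
        · subst h3
          rw [σ.squareChart_fst (show d'.snd = d'.symm.fst from rfl)]
          simp only [Dart.symm_symm, quarter.neg_mul_cancel]
          congr 1; ring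
        · rw [σ.squareChart_of_ne (v := d'.snd) (fun h => h3 (hdart d'.symm d h h2)) fun h => hne' (h2.trans h.symm)]
          apply collapse_eq_zero
          rw [neg_mem_doubleSquare]
          refine hside d' d.symm (fun h => h3 ?_) h2 _
          rw [h, Dart.symm_symm]
      · rw [σ.squareChart_of_ne h1 h2]
        by_cases h3 : d'.snd = d.fst
        · rw [σ.squareChart_fst h3]
          exact (collapse_eq_zero (hside' d'.symm d (fun h => h2 (by rw [← h]; rfl)) h3 _)).symm
        · by_cases h4 : d'.snd = d.snd
          · rw [σ.squareChart_snd h4]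
            refine (collapse_eq_zero ?_).symm
            rw [neg_mem_doubleSquare]
            refine hside' d'.symm d.symm (fun h => h1 ?_) h4 _
            exact congrArg (fun a : G.Dart => a.snd) h
          · rw [σ.squareChart_of_ne h3 h4]

/-- The chart of the surface that the dart `d` determines. -/
noncomputable def chart (d : G.Dart) : R.Surface → ℂ × ℝ :=
  Quot.lift (fun c => σ.squareChart d c.1.fst (σ.pos c))
    fun _ _ h => σ.squareChart_eq_of_glue hσ d h

theorem continuous_chart (d : G.Dart) : Continuous (σ.chart hσ d) :=
  continuous_quot_lift _ (σ.continuous_squareChart_pos d)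

variable [Nonempty R.Surface]

theorem chart_square_fst (d : G.Dart) {z : ℂ} (hz : z ∈ vertexSquare) :
    σ.chart hσ d (σ.square d.fst z) = collapse (1 - quarter (-σ.side d) * z) := by
  obtain ⟨c, hc, rfl⟩ := σ.exists_corner hσ d.fst hz
  rw [← hc, ← σ.mk_eq_square hσ]
  exact σ.squareChart_fst hc _

theorem chart_square_snd (d : G.Dart) {z : ℂ} (hz : z ∈ vertexSquare) :
    σ.chart hσ d (σ.square d.snd z) = collapse (-(1 - quarter (-σ.side d.symm) * z)) := by
  obtain ⟨c, hc, rfl⟩ := σ.exists_corner hσ d.snd hz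
  rw [← hc, ← σ.mk_eq_square hσ]
  exact σ.squareChart_snd hc _

theorem chart_square_of_ne (d : G.Dart) {v : V} (h : v ≠ d.fst) (h' : v ≠ d.snd) {z : ℂ}
    (hz : z ∈ vertexSquare) : σ.chart hσ d (σ.square v z) = 0 := by
  obtain ⟨c, rfl, rfl⟩ := σ.exists_corner hσ v hz
  rw [← σ.mk_eq_square hσ]
  exact σ.squareChart_of_ne h h' _

omit hσ in
/-- The inverse of the chart at `d`, on `doubleSquare`. -/
noncomputable def double (d : G.Dart) (w : ℂ) : R.Surface :=
  if 0 ≤ w.re then σ.square d.fst (quarter (σ.side d) * (1 - w))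
  else σ.square d.snd (quarter (σ.side d.symm) * (1 + w))

omit hσ in
theorem double_of_nonneg (d : G.Dart) {w : ℂ} (h : 0 ≤ w.re) :
    σ.double d w = σ.square d.fst (quarter (σ.side d) * (1 - w)) := if_pos h

theorem double_of_nonpos (d : G.Dart) {w : ℂ} (h : w.re ≤ 0) (hw : w ∈ doubleSquare) :
    σ.double d w = σ.square d.snd (quarter (σ.side d.symm) * (1 + w)) := by
  rcases h.lt_or_eq with h | h
  · exact if_neg (not_le.mpr h)
  · rw [double, if_pos h.ge]
    have h1 : w = (w.im : ℂ) * I := by apply Complex.ext <;> simp [h]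
    have := σ.square_side hσ d (t := -w.im) (by rw [abs_neg]; exact hw.2.le)
    push_cast at this
    simp only [neg_mul, sub_neg_eq_add, ← sub_eq_add_neg] at this
    rwa [← h1] at this

theorem double_symm (d : G.Dart) {w : ℂ} (hw : w ∈ doubleSquare) :
    σ.double d.symm w = σ.double d (-w) := by
  rcases le_total 0 w.re with h | h
  · rw [σ.double_of_nonneg _ h, σ.double_of_nonpos hσ d (by simpa using h)
      (neg_mem_doubleSquare.mpr hw), ← sub_eq_add_neg]
    rfl
  · rw [σ.double_of_nonpos hσ d.symm h hw, σ.double_of_nonneg d (by simpa using h), sub_neg_eq_add,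
      Dart.symm_symm]
    rfl

theorem chart_double (d : G.Dart) {w : ℂ} (hw : w ∈ doubleSquare) :
    σ.chart hσ d (σ.double d w) = collapse w := by
  rcases le_total 0 w.re with h | h
  · rw [σ.double_of_nonneg d h, σ.chart_square_fst hσ d
      (quarter_mul_mem_vertexSquare _ (one_sub_mem_vertexSquare hw h)), quarter.neg_mul_cancel,
      sub_sub_cancel]
  · rw [σ.double_of_nonpos hσ d h hw, σ.chart_square_snd hσ d
      (quarter_mul_mem_vertexSquare _ (one_add_mem_vertexSquare hw h)), quarter.neg_mul_cancel]
    congr 1; ring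

/-- Uniqueness of the position in the squares, away from their corners. -/
theorem square_eq_double (d : G.Dart) {v : V} {z w : ℂ} (hz : z ∈ vertexSquare)
    (hw : w ∈ doubleSquare) (h : σ.chart hσ d (σ.square v z) = collapse w) :
    (v = d.fst ∧ z = quarter (σ.side d) * (1 - w) ∧ 0 ≤ w.re) ∨
      (v = d.snd ∧ z = quarter (σ.side d.symm) * (1 + w) ∧ w.re ≤ 0) := by
  by_cases h1 : v = d.fst
  · subst h1
    rw [σ.chart_square_fst hσ d hz] at h
    have h2 := collapse_injOn hw h.symm
    have h3 := quarter_mul_mem_vertexSquare (-σ.side d) hz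
    refine Or.inl ⟨rfl, ?_, ?_⟩
    · rw [h2, sub_sub_cancel, quarter.mul_neg_cancel]
    · rw [h2]
      have := (abs_le.mp h3.1).2
      simp only [sub_re, one_re]
      linarith
  · by_cases h1' : v = d.snd
    · subst h1'
      rw [σ.chart_square_snd hσ d hz] at h
      have h2 := collapse_injOn hw h.symm
      have h3 := quarter_mul_mem_vertexSquare (-σ.side d.symm) hz
      refine Or.inr ⟨rfl, ?_, ?_⟩
      · rw [h2, neg_sub, add_sub_cancel, quarter.mul_neg_cancel]
      · rw [h2]
        have := (abs_le.mp h3.1).2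
        simp only [neg_re, sub_re, one_re]
        linarith
    · rw [σ.chart_square_of_ne hσ d h1 h1' hz] at h
      exact absurd h.symm (collapse_ne_zero hw)

theorem eq_double_of_chart_eq (d : G.Dart) {p : R.Surface} {w : ℂ} (hw : w ∈ doubleSquare)
    (h : σ.chart hσ d p = collapse w) : p = σ.double d w := by
  obtain ⟨v, z, hz, rfl⟩ := σ.exists_square_eq hσ p
  rcases σ.square_eq_double hσ d hz hw h with ⟨rfl, rfl, h'⟩ | ⟨rfl, rfl, h'⟩
  · rw [σ.double_of_nonneg d h']
  · rw [σ.double_of_nonpos hσ d h' hw]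

theorem double_injOn (d : G.Dart) : Set.InjOn (σ.double d) doubleSquare := by
  intro w hw w' hw' h
  apply collapse_injOn hw
  rw [← σ.chart_double hσ d hw, h, σ.chart_double hσ d hw']

/-- The chart is a closed map, from a compact to a Hausdorff space, so the preimage of a closed set
under its inverse is closed. -/
theorem continuousOn_double [CompactSpace R.Surface] (d : G.Dart) :
    ContinuousOn (σ.double d) doubleSquare := by
  rw [continuousOn_iff_isClosed]
  intro K hK
  refine ⟨collapse ⁻¹' (σ.chart hσ d '' K),
    ((σ.continuous_chart hσ d).isClosedMap K hK).preimage continuous_collapse, ?_⟩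
  ext w
  constructor
  · rintro ⟨hK', hw⟩
    exact ⟨⟨_, hK', σ.chart_double hσ d hw⟩, hw⟩
  · rintro ⟨⟨p, hp, h⟩, hw⟩
    rw [σ.eq_double_of_chart_eq hσ d hw h] at hp
    exact ⟨hp, hw⟩

/-- On the domain of the chart the second coordinate is positive, and division by it recovers `w`;
both conditions are open on the surface. -/
theorem isOpen_double_image (d : G.Dart) {O : Set ℂ} (hO : IsOpen O) (hOT : O ⊆ doubleSquare) :
    IsOpen (σ.double d '' O) := by
  have h : σ.double d '' O =
      (σ.chart hσ d) ⁻¹' {p | 0 < p.2} ∩ {p | (σ.chart hσ d p).2⁻¹ • (σ.chart hσ d p).1 ∈ O} := by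
    have inv : ∀ w ∈ doubleSquare, (collapse w).2⁻¹ • (collapse w).1 = w := fun w hw =>
      inv_smul_smul₀ (bump_pos_iff.mpr hw).ne' w
    ext p
    constructor
    · rintro ⟨w, hw, rfl⟩
      rw [Set.mem_inter_iff, Set.mem_preimage, Set.mem_ofPred_eq, Set.mem_ofPred_eq,
        σ.chart_double hσ d (hOT hw), inv w (hOT hw)]
      exact ⟨bump_pos_iff.mpr (hOT hw), hw⟩
    · rintro ⟨h1, h2⟩
      rw [Set.mem_preimage, Set.mem_ofPred_eq] at h1
      obtain ⟨w, hw⟩ : ∃ w, σ.chart hσ d p = collapse w := by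
        obtain ⟨v, z, hz, rfl⟩ := σ.exists_square_eq hσ p
        by_cases h3 : v = d.fst
        · subst h3; exact ⟨_, σ.chart_square_fst hσ d hz⟩
        · by_cases h4 : v = d.snd
          · subst h4; exact ⟨_, σ.chart_square_snd hσ d hz⟩
          · rw [σ.chart_square_of_ne hσ d h3 h4 hz] at h1
            exact absurd h1 (lt_irrefl _)
      rw [hw] at h1
      have hwT : w ∈ doubleSquare := bump_pos_iff.mp h1
      rw [Set.mem_ofPred_eq, hw, inv w hwT] at h2
      exact ⟨w, h2, (σ.eq_double_of_chart_eq hσ d hwT hw).symm⟩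
  rw [h]
  have hc := σ.continuous_chart hσ d
  refine ContinuousOn.isOpen_inter_preimage (t := O) ?_ ?_ hO
  · refine ContinuousOn.smul (ContinuousOn.inv₀ (continuous_snd.comp hc).continuousOn
      fun p hp => ?_) (continuous_fst.comp hc).continuousOn
    exact ne_of_gt (Set.mem_preimage.mp hp)
  · exact (isOpen_lt continuous_const continuous_snd).preimage hc

/-- The chart as a homeomorphism, on an open subset of `doubleSquare`. -/
noncomputable def doubleHomeomorph [CompactSpace R.Surface] (d : G.Dart) {O : Set ℂ}
    (hO : IsOpen O) (hOT : O ⊆ doubleSquare) : O ≃ₜ σ.double d '' O :=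
  have h : Topology.IsOpenEmbedding (O.domRestrict (σ.double d)) := by
    refine Topology.IsOpenEmbedding.of_continuous_injective_isOpenMap ?_ ?_ ?_
    · exact ((σ.continuousOn_double hσ d).mono hOT).domRestrict
    · exact Set.injOn_iff_injective.mp ((σ.double_injOn hσ d).mono hOT)
    · intro W hW
      have := σ.isOpen_double_image hσ d (hO.isOpenMap_subtype_val W hW)
        ((Subtype.coe_image_subset O W).trans hOT)
      rwa [Set.image_image] at this
  h.toIsEmbedding.toHomeomorph.trans (Homeomorph.setCongr (Set.range_domRestrict _ _))

end

end RotationSystem.SideChoice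

/-! ### Grid points and rays in a square -/

/-- The coordinate of the `i`-th line of a grid of `δ` lines in the interval `[-1, 1]`. -/
noncomputable def gridCoord {δ : ℕ} (i : Fin δ) : ℝ := (2 * (i : ℕ) + 1 - δ) / δ

/-- The position of a vertex of the grid; the sides `0, 1, 2, 3` of the grid lie in the directions
`1, I, -1, -I`. -/
noncomputable def gridPos {δ : ℕ} (p : Fin δ × Fin δ) : ℂ := ⟨gridCoord p.2, gridCoord p.1⟩

/-- The point at distance `r / δ` from a vertex of the grid in the direction `k`. -/
noncomputable def gridRay {δ : ℕ} (p : Fin δ × Fin δ) (k : Fin 4) (r : ℝ) : ℂ :=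
  gridPos p + ((r / δ : ℝ) : ℂ) * quarter k

section

variable {δ : ℕ}

theorem Fin.cast_pos_real (i : Fin δ) : (0 : ℝ) < δ := by exact_mod_cast i.pos

theorem gridCoord_mul (i : Fin δ) : δ * gridCoord i = 2 * (i : ℕ) + 1 - δ := by
  have := i.cast_pos_real
  unfold gridCoord
  field_simp

theorem gridCoord_rev (i : Fin δ) : gridCoord i.rev = -gridCoord i := by
  have h : ((i.rev : ℕ) : ℝ) = δ - 1 - (i : ℕ) := by
    have : (i.rev : ℕ) + (i + 1) = δ := by rw [Fin.val_rev]; omega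
    have : ((i.rev : ℕ) : ℝ) + ((i : ℕ) + 1) = δ := by exact_mod_cast this
    linarith
  unfold gridCoord
  rw [h]; ring

theorem abs_gridCoord_le (i : Fin δ) : |gridCoord i| ≤ 1 - 1 / δ := by
  have h := i.cast_pos_real
  have h1 : ((i : ℕ) : ℝ) + 1 ≤ δ := by exact_mod_cast i.isLt
  have h2 : (0 : ℝ) ≤ (i : ℕ) := Nat.cast_nonneg _
  unfold gridCoord
  rw [abs_div, abs_of_pos h, div_le_iff₀ h, sub_mul, one_div_mul_cancel h.ne', abs_le]
  constructor <;> linarith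

theorem abs_gridCoord_lt (i : Fin δ) : |gridCoord i| < 1 := by
  have h := i.cast_pos_real
  have := abs_gridCoord_le i
  have : (0 : ℝ) < 1 / δ := by positivity
  linarith

theorem gridCoord_last (h : δ - 1 < δ) : gridCoord (⟨δ - 1, h⟩ : Fin δ) = 1 - 1 / δ := by
  have h' : (0 : ℝ) < δ := by exact_mod_cast (by omega : 0 < δ)
  have : ((δ - 1 : ℕ) : ℝ) = δ - 1 := by rw [Nat.cast_sub (by omega)]; simp
  unfold gridCoord
  simp only [this]
  field_simp; ring

theorem gridCoord_first (h : 0 < δ) : gridCoord (⟨0, h⟩ : Fin δ) = -(1 - 1 / δ) := by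
  have h' : (0 : ℝ) < δ := by exact_mod_cast (by omega : 0 < δ)
  unfold gridCoord
  simp only [Nat.cast_zero]
  field_simp; ring

theorem gridCoord_succ {i j : Fin δ} (h : (i : ℕ) + 1 = j) :
    gridCoord j = gridCoord i + 2 / δ := by
  have := i.cast_pos_real
  unfold gridCoord
  rw [← h]; push_cast; field_simp; ring

theorem gridCoord_injective : Function.Injective (gridCoord (δ := δ)) := by
  intro i j h
  have hi := gridCoord_mul i
  rw [h, gridCoord_mul] at hi
  have : ((i : ℕ) : ℝ) = (j : ℕ) := by linarith
  exact Fin.ext (by exact_mod_cast this)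

theorem gridPos_injective : Function.Injective (gridPos (δ := δ)) := by
  intro p q h
  have h1 := congrArg Complex.re h
  have h2 := congrArg Complex.im h
  exact Prod.ext (gridCoord_injective h2) (gridCoord_injective h1)

/-- The exchange of the coordinates in `gridPos` reflects the grid, so that its clockwise sides
follow the counterclockwise powers of `I`. The margin `1 / δ` is half the spacing of the lines,
which makes edges between grids as long as those inside. -/
theorem gridPos_gridSegment (k : Fin 4) (i : Fin δ) :
    gridPos (gridSegment k i) =
      quarter k * ((1 - 1 / δ : ℝ) + (gridCoord i : ℝ) * Complex.I) := by
  have h := i.pos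
  fin_cases k <;> apply Complex.ext <;>
    simp [gridPos, gridSegment, quarter, gridCoord_rev, gridCoord_last, gridCoord_first h,
      Complex.I_pow_three]

theorem gridRay_zero (p : Fin δ × Fin δ) (k : Fin 4) : gridRay p k 0 = gridPos p := by
  simp [gridRay]

theorem quarter_re_im (k : Fin 4) :
    |(quarter k).re| ≤ 1 ∧ |(quarter k).im| ≤ 1 := by
  rcases quarter.cases k with h | h | h | h <;> simp [h]

/-- The interior of `vertexSquare`. -/
def openSquare : Set ℂ := {z | |z.re| < 1 ∧ |z.im| < 1}

theorem openSquare_subset : openSquare ⊆ vertexSquare := fun _ h => ⟨h.1.le, h.2.le⟩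

theorem quarter_mul_mem_openSquare (k : Fin 4) {z : ℂ} (hz : z ∈ openSquare) :
    quarter k * z ∈ openSquare := by
  obtain ⟨h1, h2⟩ := hz
  rcases quarter.cases k with h | h | h | h <;> rw [h] <;> simp [openSquare, h1, h2]

theorem convex_openSquare : Convex ℝ openSquare := by
  intro z hz w hw a b ha hb hab
  simp only [openSquare, Set.mem_ofPred_eq, abs_lt] at *
  simp only [Complex.add_re, Complex.add_im, Complex.real_smul, Complex.re_ofReal_mul,
    Complex.im_ofReal_mul]
  have key : ∀ x y : ℝ, -1 < x → x < 1 → -1 < y → y < 1 →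
      -1 < a * x + b * y ∧ a * x + b * y < 1 := by
    intro x y h1 h2 h3 h4
    rcases ha.eq_or_lt with rfl | ha
    · have : b = 1 := by linarith
      subst this; constructor <;> linarith
    · have e1 := mul_lt_mul_of_pos_left h1 ha
      have e2 := mul_lt_mul_of_pos_left h2 ha
      have e3 := mul_le_mul_of_nonneg_left h3.le hb
      have e4 := mul_le_mul_of_nonneg_left h4.le hb
      constructor <;> nlinarith
  exact ⟨key _ _ hz.1.1 hz.1.2 hw.1.1 hw.1.2, key _ _ hz.2.1 hz.2.2 hw.2.1 hw.2.2⟩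

theorem gridPos_mem (p : Fin δ × Fin δ) : gridPos p ∈ openSquare :=
  ⟨abs_gridCoord_lt _, abs_gridCoord_lt _⟩

theorem abs_add_div_mul_le (i : Fin δ) {r a : ℝ} (hr : 0 ≤ r) (ha : |a| ≤ 1) :
    |gridCoord i + r / δ * a| ≤ 1 - (1 - r) / δ := by
  have h := i.cast_pos_real
  have h1 := abs_gridCoord_le i
  have h2 : |r / δ * a| ≤ r / δ := by
    rw [abs_mul, abs_of_nonneg (by positivity : 0 ≤ r / δ)]
    exact mul_le_of_le_one_right (by positivity) ha
  have h3 := abs_add_le (gridCoord i) (r / δ * a)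
  have h4 : (1 - r) / δ = 1 / δ - r / δ := by ring
  linarith

theorem gridRay_re (p : Fin δ × Fin δ) (k : Fin 4) (r : ℝ) :
    (gridRay p k r).re = gridCoord p.2 + r / δ * (quarter k).re := by
  rw [gridRay, Complex.add_re, Complex.re_ofReal_mul]; rfl

theorem gridRay_im (p : Fin δ × Fin δ) (k : Fin 4) (r : ℝ) :
    (gridRay p k r).im = gridCoord p.1 + r / δ * (quarter k).im := by
  rw [gridRay, Complex.add_im, Complex.im_ofReal_mul]; rfl

theorem gridRay_mem_vertexSquare (p : Fin δ × Fin δ) (k : Fin 4) {r : ℝ} (h0 : 0 ≤ r)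
    (h1 : r ≤ 1) : gridRay p k r ∈ vertexSquare := by
  have h := p.1.cast_pos_real
  have h' : 0 ≤ (1 - r) / δ := div_nonneg (by linarith) h.le
  refine ⟨?_, ?_⟩
  · rw [gridRay_re]
    linarith [abs_add_div_mul_le p.2 h0 (quarter_re_im k).1]
  · rw [gridRay_im]
    linarith [abs_add_div_mul_le p.1 h0 (quarter_re_im k).2]

theorem gridRay_mem_openSquare (p : Fin δ × Fin δ) (k : Fin 4) {r : ℝ} (h0 : 0 ≤ r)
    (h1 : r < 1) : gridRay p k r ∈ openSquare := by
  have h := p.1.cast_pos_real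
  have h' : 0 < (1 - r) / δ := div_pos (by linarith) h
  refine ⟨?_, ?_⟩
  · rw [gridRay_re]
    linarith [abs_add_div_mul_le p.2 h0 (quarter_re_im k).1]
  · rw [gridRay_im]
    linarith [abs_add_div_mul_le p.1 h0 (quarter_re_im k).2]

theorem gridCoord_eq_of_add_eq {i j : Fin δ} {a b : ℝ} (h : gridCoord i + a / δ = gridCoord j + b / δ)
    (hab : |a - b| < 2) : i = j := by
  have hδ := i.cast_pos_real
  have h1 := gridCoord_mul i
  have h2 := gridCoord_mul j
  have h3 : δ * gridCoord i + a = δ * gridCoord j + b := by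
    have := congrArg (fun x => (δ : ℝ) * x) h
    simp only [mul_add, mul_div_cancel₀ _ hδ.ne'] at this
    exact this
  rw [abs_lt] at hab
  have h4 : ((i : ℕ) : ℝ) < (j : ℕ) + 1 := by linarith
  have h5 : ((j : ℕ) : ℝ) < (i : ℕ) + 1 := by linarith
  have h6 : (i : ℕ) < j + 1 := by exact_mod_cast h4
  have h7 : (j : ℕ) < i + 1 := by exact_mod_cast h5
  exact Fin.ext (by omega)

/-- Grid points differ by at least `2 / δ` in some coordinate, and two rays, one of them shorter
than `1 / δ`, cannot bridge this distance. So the crosses around the grid points are disjoint up to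
their tips. -/
theorem gridRay_inj {p q : Fin δ × Fin δ} {k l : Fin 4} {r s : ℝ} (hr0 : 0 ≤ r) (hr : r < 1)
    (hs0 : 0 ≤ s) (hs : s ≤ 1) (h : gridRay p k r = gridRay q l s) :
    p = q ∧ r = s ∧ (0 < r → k = l) := by
  have hδ := p.1.cast_pos_real
  have bd : ∀ a b : ℝ, |a| ≤ 1 → |b| ≤ 1 → |r * a - s * b| < 2 := by
    intro a b ha hb
    have h1 := abs_sub (r * a) (s * b)
    rw [abs_mul, abs_mul, abs_of_nonneg hr0, abs_of_nonneg hs0] at h1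
    have h2 := mul_le_of_le_one_right hr0 ha
    have h3 := mul_le_of_le_one_right hs0 hb
    linarith
  have hpq : p = q := by
    have h1 := congrArg Complex.re h
    have h2 := congrArg Complex.im h
    rw [gridRay_re, gridRay_re, div_mul_eq_mul_div, div_mul_eq_mul_div] at h1
    rw [gridRay_im, gridRay_im, div_mul_eq_mul_div, div_mul_eq_mul_div] at h2
    exact Prod.ext (gridCoord_eq_of_add_eq h2 (bd _ _ (quarter_re_im k).2 (quarter_re_im l).2))
      (gridCoord_eq_of_add_eq h1 (bd _ _ (quarter_re_im k).1 (quarter_re_im l).1))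
  subst hpq
  have h1 : (r : ℂ) * quarter k = s * quarter l := by
    have h2 := add_left_cancel h
    push_cast at h2
    have hc : (δ : ℂ) ≠ 0 := by exact_mod_cast hδ.ne'
    field_simp at h2
    exact h2
  have hn : ∀ k, ‖quarter k‖ = 1 := fun k => by
    rcases quarter.cases k with h | h | h | h <;> simp [h]
  have hrs : r = s := by
    have := congrArg norm h1
    simpa [hn, abs_of_nonneg hr0, abs_of_nonneg hs0] using this
  refine ⟨rfl, hrs, fun hr' => ?_⟩
  rw [← hrs] at h1
  have h2 := mul_left_cancel₀ (by exact_mod_cast hr'.ne') h1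
  have h3 : quarter (k - l) = 1 := by
    rw [sub_eq_add_neg, quarter.add, h2, quarter.mul_neg_self]
  have h4 : ∀ m : Fin 4, quarter m = 1 → m = 0 := by
    intro m hm
    fin_cases m
    · rfl
    · have := congrArg Complex.re hm; simp [quarter] at this
    · have := congrArg Complex.re hm; simp [quarter] at this; norm_num at this
    · have := congrArg Complex.re hm; simp [quarter, Complex.I_pow_three] at this
  exact sub_eq_zero.mp (h4 _ h3)

/-- Tips of rays can also meet halfway between two neighbours that face each other. Multiplied by
`δ`, the coordinates differ from each other by integers, so the sixteen pairs of directions are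
settled by parity. -/
theorem gridRay_one_eq {p q : Fin δ × Fin δ} {k l : Fin 4} (h : gridRay p k 1 = gridRay q l 1) :
    (p = q ∧ k = l) ∨ (l = k + 2 ∧ gridPos q = gridRay p k 2) := by
  have hδ := p.1.cast_pos_real
  have key : ∀ (i j : Fin δ) (a b : ℤ), gridCoord i + 1 / δ * a = gridCoord j + 1 / δ * b →
      2 * ((i : ℕ) : ℤ) + a = 2 * ((j : ℕ) : ℤ) + b := by
    intro i j a b h
    have h1 := gridCoord_mul i
    have h2 := gridCoord_mul j
    have h3 : δ * gridCoord i + a = δ * gridCoord j + b := by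
      have := congrArg (fun x => (δ : ℝ) * x) h
      simp only [mul_add, ← mul_assoc, mul_one_div_cancel hδ.ne', one_mul] at this
      exact this
    have h4 : 2 * ((i : ℕ) : ℝ) + a = 2 * ((j : ℕ) : ℝ) + b := by linarith
    exact_mod_cast h4
  have hq : ∀ k : Fin 4, ∃ a b : ℤ, quarter k = ⟨a, b⟩ ∧
      ((k = 0 ∧ a = 1 ∧ b = 0) ∨ (k = 1 ∧ a = 0 ∧ b = 1) ∨
      (k = 2 ∧ a = -1 ∧ b = 0) ∨ (k = 3 ∧ a = 0 ∧ b = -1)) := by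
    intro k
    fin_cases k
    · exact ⟨1, 0, by apply Complex.ext <;> simp [quarter], by simp⟩
    · exact ⟨0, 1, by apply Complex.ext <;> simp [quarter], by simp⟩
    · exact ⟨-1, 0, by apply Complex.ext <;> simp [quarter], by simp⟩
    · exact ⟨0, -1, by apply Complex.ext <;> simp [quarter, Complex.I_pow_three], by simp⟩
  obtain ⟨a, b, hk, hk'⟩ := hq k
  obtain ⟨c, d, hl, hl'⟩ := hq l
  have h1 := congrArg Complex.re h
  have h2 := congrArg Complex.im h
  rw [gridRay_re, gridRay_re, hk, hl] at h1
  rw [gridRay_im, gridRay_im, hk, hl] at h2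
  have h1' := key _ _ _ _ h1
  have h2' := key _ _ _ _ h2
  have hl2 : l = k + 2 → gridPos q = gridRay p k 2 := by
    intro e
    have h3 : quarter l = -quarter k := by
      rw [e, quarter.add]; simp [quarter]
    rw [gridRay, gridRay, h3] at h
    rw [gridRay]
    push_cast at h ⊢
    linear_combination -h
  have hpq : k = l → p = q := by
    intro e
    have : (⟨a, b⟩ : ℂ) = ⟨c, d⟩ := by rw [← hk, ← hl, e]
    have e1 : a = c := Int.cast_injective (α := ℝ) (congrArg Complex.re this)
    have e2 : b = d := Int.cast_injective (α := ℝ) (congrArg Complex.im this)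
    exact Prod.ext (Fin.ext (by omega)) (Fin.ext (by omega))
  rcases hk' with ⟨rfl, rfl, rfl⟩ | ⟨rfl, rfl, rfl⟩ | ⟨rfl, rfl, rfl⟩ | ⟨rfl, rfl, rfl⟩ <;>
    rcases hl' with ⟨rfl, rfl, rfl⟩ | ⟨rfl, rfl, rfl⟩ | ⟨rfl, rfl, rfl⟩ | ⟨rfl, rfl, rfl⟩ <;>
    first
    | exact Or.inl ⟨hpq rfl, rfl⟩
    | exact Or.inr ⟨rfl, hl2 rfl⟩
    | (exfalso; omega)

/-- A full step outward from the outermost line ends at distance `1 + 1 / δ` from the axis, outside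
the square. Hence inner edges and edges across a side never leave a vertex in the same direction. -/
theorem gridRay_gridSegment_two_ne (k : Fin 4) (i : Fin δ) (p : Fin δ × Fin δ) :
    gridPos p ≠ gridRay (gridSegment k i) k 2 := by
  intro h
  have hδ := i.cast_pos_real
  have h1 := quarter_mul_mem_openSquare (-k) (gridPos_mem p)
  rw [h, gridRay, gridPos_gridSegment, mul_comm _ (quarter k), ← mul_add,
    quarter.neg_mul_cancel] at h1
  have h2 := (abs_lt.mp h1.1).2
  simp at h2
  have h3 : (2 : ℝ) / δ = (δ : ℝ)⁻¹ + (δ : ℝ)⁻¹ := by ring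
  have : (0 : ℝ) < (δ : ℝ)⁻¹ := by positivity
  linarith

end

/-! ### Edges of the blow-up by direction -/

namespace RotationSystem.SideChoice

open SimpleGraph Complex

variable {V : Type u} {G : SimpleGraph V} {R : RotationSystem G} (σ : R.SideChoice) {δ : ℕ}

/-- The edge of the blow-up from `x` to `y` leaves `x` in the direction `k`. -/
def IsDirection (x y : V × (Fin δ × Fin δ)) (k : Fin 4) : Prop :=
  (x.1 = y.1 ∧ gridPos y.2 = gridRay x.2 k 2) ∨
    ∃ d : G.Dart, d.fst = x.1 ∧ d.snd = y.1 ∧ σ.side d = k ∧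
      ∃ i : Fin δ, x.2 = gridSegment k i ∧ y.2 = gridSegment (σ.side d.symm) i.rev

theorem gridSegment_injective (k : Fin 4) : Function.Injective (gridSegment (δ := δ) k) :=
  Function.LeftInverse.injective (gridLine_gridSegment k)

theorem gridPos_eq_gridRay_two {p q : Fin δ × Fin δ} :
    ((pathGraph δ).boxProd (pathGraph δ)).Adj p q ↔ ∃ k, gridPos q = gridRay p k 2 := by
  constructor
  · intro h
    have q3 : quarter 3 = -I := by simp [quarter, I_pow_three]
    have q2 : quarter 2 = -1 := by simp [quarter]
    rw [boxProd_adj, pathGraph_adj, pathGraph_adj] at h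
    rcases h with ⟨h | h, h'⟩ | ⟨h | h, h'⟩
    · refine ⟨1, Complex.ext ?_ ?_⟩
      · rw [gridRay_re, quarter.one]; simp [gridPos, h']
      · rw [gridRay_im, quarter.one]; simp [gridPos, gridCoord_succ h]
    · refine ⟨3, Complex.ext ?_ ?_⟩
      · rw [gridRay_re, q3]; simp [gridPos, h']
      · rw [gridRay_im, q3]; simp [gridPos, gridCoord_succ h]
    · refine ⟨0, Complex.ext ?_ ?_⟩
      · rw [gridRay_re, quarter.zero]; simp [gridPos, gridCoord_succ h]
      · rw [gridRay_im, quarter.zero]; simp [gridPos, h']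
    · refine ⟨2, Complex.ext ?_ ?_⟩
      · rw [gridRay_re, q2]; simp [gridPos, gridCoord_succ h]
      · rw [gridRay_im, q2]; simp [gridPos, h']
  · rintro ⟨k, h⟩
    have hδ := p.1.cast_pos_real
    have key : ∀ (i j : Fin δ) (a : ℤ), gridCoord j = gridCoord i + 2 / δ * a →
        ((j : ℕ) : ℤ) = (i : ℕ) + a := by
      intro i j a h
      have h1 := gridCoord_mul i
      have h2 := gridCoord_mul j
      rw [h, mul_add, ← mul_assoc, mul_div_cancel₀ _ hδ.ne', h1] at h2
      have h3 : ((j : ℕ) : ℝ) = (i : ℕ) + a := by linarith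
      exact_mod_cast h3
    have hq : ∀ a b : ℤ, quarter k = ⟨a, b⟩ → ((q.2 : ℕ) : ℤ) = (p.2 : ℕ) + a ∧
        ((q.1 : ℕ) : ℤ) = (p.1 : ℕ) + b := by
      intro a b hk
      have h1 := congrArg Complex.re h
      have h2 := congrArg Complex.im h
      rw [gridRay_re, hk] at h1
      rw [gridRay_im, hk] at h2
      exact ⟨key _ _ _ h1, key _ _ _ h2⟩
    rw [boxProd_adj, pathGraph_adj, pathGraph_adj, Fin.ext_iff, Fin.ext_iff]
    rcases quarter.cases k with hk | hk | hk | hk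
    · have := hq 1 0 (by rw [hk]; apply Complex.ext <;> simp); omega
    · have := hq 0 1 (by rw [hk]; apply Complex.ext <;> simp); omega
    · have := hq (-1) 0 (by rw [hk]; apply Complex.ext <;> simp); omega
    · have := hq 0 (-1) (by rw [hk]; apply Complex.ext <;> simp); omega

theorem blowUp_adj_iff {x y : V × (Fin δ × Fin δ)} :
    (σ.blowUp δ).Adj x y ↔ ∃ k, σ.IsDirection x y k := by
  constructor
  · rintro (⟨h, h'⟩ | ⟨d, hx, hy, i, hi, hj⟩)
    · obtain ⟨k, hk⟩ := gridPos_eq_gridRay_two.mp h'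
      exact ⟨k, Or.inl ⟨h, hk⟩⟩
    · exact ⟨_, Or.inr ⟨d, hx, hy, rfl, i, hi, hj⟩⟩
  · rintro ⟨k, ⟨h, h'⟩ | ⟨d, hx, hy, rfl, i, hi, hj⟩⟩
    · exact Or.inl ⟨h, gridPos_eq_gridRay_two.mpr ⟨k, h'⟩⟩
    · exact Or.inr ⟨d, hx, hy, i, hi, hj⟩

section

variable (hσ : Function.Bijective fun d : G.Dart => (d.fst, σ.side d))

include hσ

theorem IsDirection.unique {x y y' : V × (Fin δ × Fin δ)} {k : Fin 4} (h : σ.IsDirection x y k)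
    (h' : σ.IsDirection x y' k) : y = y' := by
  rcases h with ⟨h1, h2⟩ | ⟨d, hx, hy, hk, i, hi, hj⟩ <;>
    rcases h' with ⟨h1', h2'⟩ | ⟨d', hx', hy', hk', i', hi', hj'⟩
  · exact Prod.ext (h1.symm.trans h1') (gridPos_injective (h2.trans h2'.symm))
  · rw [hi'] at h2
    exact absurd h2 (gridRay_gridSegment_two_ne k i' _)
  · rw [hi] at h2'
    exact absurd h2' (gridRay_gridSegment_two_ne k i _)
  · have hd : d = d' := hσ.1 (Prod.ext (hx.trans hx'.symm) (hk.trans hk'.symm))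
    subst hd
    have hii : i = i' := gridSegment_injective k (hi.symm.trans hi')
    subst hii
    exact Prod.ext (hy.symm.trans hy') (hj.trans hj'.symm)

/-- Either the grid continues in this direction, or the vertex lies on the segment of this side and
the dart of the side supplies the edge. Thus no ray of the drawing remains unused. -/
theorem exists_isDirection (x : V × (Fin δ × Fin δ)) (k : Fin 4) :
    ∃ y, σ.IsDirection x y k := by
  obtain ⟨v, i, j⟩ := x
  have cross : ∀ s, (i, j) = gridSegment k s → ∃ y, σ.IsDirection (v, i, j) y k := by
    intro s hs
    obtain ⟨d, hd⟩ := hσ.2 (v, k)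
    simp only [Prod.mk.injEq] at hd
    exact ⟨(d.snd, gridSegment (σ.side d.symm) s.rev), Or.inr ⟨d, hd.1, rfl, hd.2, s, hs, rfl⟩⟩
  have inner : ∀ q, gridPos q = gridRay (i, j) k 2 → ∃ y, σ.IsDirection (v, i, j) y k :=
    fun q h => ⟨(v, q), Or.inl ⟨rfl, h⟩⟩
  have q3 : quarter 3 = -I := by simp [quarter, I_pow_three]
  have q2 : quarter 2 = -1 := by simp [quarter]
  have hi := i.isLt
  have hj := j.isLt
  fin_cases k
  · by_cases h : (j : ℕ) + 1 < δ
    · refine inner (i, ⟨j + 1, h⟩) (Complex.ext ?_ ?_)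
      · simp only [Fin.zero_eta]
        rw [gridRay_re, quarter.zero]
        simp [gridPos, gridCoord_succ (i := j) (j := ⟨j + 1, h⟩) rfl]
      · simp only [Fin.zero_eta]
        rw [gridRay_im, quarter.zero]; simp [gridPos]
    · exact cross i (Prod.ext rfl (Fin.ext (by simp [gridSegment]; omega)))
  · by_cases h : (i : ℕ) + 1 < δ
    · refine inner (⟨i + 1, h⟩, j) (Complex.ext ?_ ?_)
      · simp only [Fin.mk_one]
        rw [gridRay_re, quarter.one]; simp [gridPos]
      · simp only [Fin.mk_one]
        rw [gridRay_im, quarter.one]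
        simp [gridPos, gridCoord_succ (i := i) (j := ⟨i + 1, h⟩) rfl]
    · exact cross j.rev (Prod.ext (Fin.ext (by simp [gridSegment]; omega)) (by simp [gridSegment]))
  · by_cases h : 0 < (j : ℕ)
    · refine inner (i, ⟨j - 1, by omega⟩) (Complex.ext ?_ ?_)
      · simp only [Fin.reduceFinMk]
        rw [gridRay_re, q2]
        simp [gridPos, gridCoord_succ (i := ⟨j - 1, by omega⟩) (j := j) (by simp; omega)]
      · simp only [Fin.reduceFinMk]
        rw [gridRay_im, q2]; simp [gridPos]
    · exact cross i.rev (Prod.ext (by simp [gridSegment]) (Fin.ext (by simp [gridSegment]; omega)))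
  · by_cases h : 0 < (i : ℕ)
    · refine inner (⟨i - 1, by omega⟩, j) (Complex.ext ?_ ?_)
      · simp only [Fin.reduceFinMk]
        rw [gridRay_re, q3]; simp [gridPos]
      · simp only [Fin.reduceFinMk]
        rw [gridRay_im, q3]
        simp [gridPos, gridCoord_succ (i := ⟨i - 1, by omega⟩) (j := i) (by simp; omega)]
    · exact cross j (Prod.ext (Fin.ext (by simp [gridSegment]; omega)) rfl)

variable [Nonempty R.Surface]

/-- The chart of the dart on side `0` sees the open square as `z ↦ 1 - z`, with positive real part;
this rules out a position in the adjacent square. -/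
theorem square_inj {v v' : V} {z z' : ℂ} (hz : z ∈ openSquare) (hz' : z' ∈ vertexSquare)
    (h : σ.square v z = σ.square v' z') : v = v' ∧ z = z' := by
  obtain ⟨d, hd⟩ := hσ.2 (v, 0)
  simp only [Prod.mk.injEq] at hd
  obtain ⟨rfl, hd⟩ := hd
  have h1 := abs_lt.mp hz.1
  have hw : 1 - z ∈ doubleSquare := by
    refine ⟨?_, by simpa using hz.2⟩
    rw [abs_lt]; simp; constructor <;> linarith
  have hc := σ.chart_square_fst hσ d (openSquare_subset hz)
  rw [h, hd, neg_zero, quarter.zero, one_mul] at hc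
  rcases σ.square_eq_double hσ d hz' hw hc with ⟨h2, h3, _⟩ | ⟨_, _, h4⟩
  · rw [hd, quarter.zero, one_mul, sub_sub_cancel] at h3
    exact ⟨h2.symm, h3.symm⟩
  · simp at h4; linarith

theorem continuousOn_square [CompactSpace R.Surface] (v : V) :
    ContinuousOn (σ.square v) openSquare := by
  obtain ⟨d, hd⟩ := hσ.2 (v, 0)
  simp only [Prod.mk.injEq] at hd
  obtain ⟨rfl, hd⟩ := hd
  have hmaps : Set.MapsTo (fun z : ℂ => 1 - z) openSquare doubleSquare := by
    intro z hz
    have h1 := abs_lt.mp hz.1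
    refine ⟨?_, by simpa using hz.2⟩
    rw [abs_lt]; simp; constructor <;> linarith
  have h : ContinuousOn (fun z => σ.double d (1 - z)) openSquare :=
    (σ.continuousOn_double hσ d).comp (by fun_prop) hmaps
  refine h.congr fun z hz => ?_
  have h1 := abs_lt.mp hz.1
  show σ.square d.fst z = σ.double d (1 - z)
  rw [σ.double_of_nonneg d (by simp; linarith), hd, quarter.zero, one_mul, sub_sub_cancel]

theorem gridRay_square_inj {x y : V × (Fin δ × Fin δ)} {k l : Fin 4} {r s : ℝ} (hr0 : 0 ≤ r)
    (hr : r < 1) (hs0 : 0 ≤ s) (hs : s ≤ 1)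
    (h : σ.square x.1 (gridRay x.2 k r) = σ.square y.1 (gridRay y.2 l s)) :
    x = y ∧ r = s ∧ (0 < r → k = l) := by
  obtain ⟨h1, h2⟩ := σ.square_inj hσ (gridRay_mem_openSquare _ _ hr0 hr)
    (gridRay_mem_vertexSquare _ _ hs0 hs) h
  obtain ⟨h3, h4⟩ := gridRay_inj hr0 hr hs0 hs h2
  exact ⟨Prod.ext h1 h3, h4⟩

/-- The midpoint of an inner edge is in the open square, by convexity, where `gridRay_one_eq`
applies. The midpoint of an edge between grids lies on a common side and has a position in either
square; each position is compared with the ray there. -/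
theorem eq_or_eq_of_midpoint {x y x' y' : V × (Fin δ × Fin δ)} {k l : Fin 4}
    (ha : σ.IsDirection x y k) (hb : σ.IsDirection x' y' l)
    (h : σ.square x.1 (gridRay x.2 k 1) = σ.square x'.1 (gridRay x'.2 l 1)) :
    (x = x' ∧ y = y') ∨ (x = y' ∧ y = x') := by
  obtain ⟨u, p⟩ := x
  obtain ⟨v, q⟩ := y
  obtain ⟨u', p'⟩ := x'
  have hmem := gridRay_mem_vertexSquare p' l zero_le_one le_rfl
  have hdir := ha
  rcases ha with ⟨rfl, h2⟩ | ⟨d, rfl, rfl, rfl, i, hi, hj⟩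
  · have hopen : gridRay p k 1 ∈ openSquare := by
      have h3 : gridRay p k 1 = (1 / 2 : ℝ) • gridPos p + (1 / 2 : ℝ) • gridPos q := by
        simp only at h2
        rw [h2, gridRay, gridRay]
        simp only [Complex.real_smul]
        push_cast
        ring
      rw [h3]
      exact convex_openSquare (gridPos_mem p) (gridPos_mem q) (by norm_num) (by norm_num)
        (by norm_num)
    obtain ⟨h3, h4⟩ := σ.square_inj hσ hopen hmem h
    simp only at h3
    subst h3
    rcases gridRay_one_eq h4 with ⟨rfl, rfl⟩ | ⟨rfl, h5⟩
    · exact Or.inl ⟨rfl, hdir.unique σ hσ hb⟩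
    · have hq : p' = q := gridPos_injective (h5.trans h2.symm)
      subst hq
      refine Or.inr ⟨?_, rfl⟩
      have hback : σ.IsDirection (u, p') (u, p) (k + 2) := by
        refine Or.inl ⟨rfl, ?_⟩
        have hq2 : quarter 2 = -1 := by simp [quarter]
        simp only [gridRay, quarter.add, hq2] at h5 ⊢
        rw [h5]; ring
      exact hback.unique σ hσ hb
  · simp only at hi hj
    have hs := abs_gridCoord_lt i
    have hw : (-(gridCoord i : ℝ) * I : ℂ) ∈ doubleSquare := by
      refine ⟨by simp, by simpa using hs⟩
    have hray : ∀ (m : Fin 4) (a : Fin δ), gridRay (gridSegment m a) m 1 =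
        quarter m * (1 + (gridCoord a : ℝ) * I) := by
      intro m a
      rw [gridRay, gridPos_gridSegment]; push_cast; ring
    have hz := gridRay_mem_vertexSquare p (σ.side d) zero_le_one le_rfl
    have hc := σ.chart_square_fst hσ d hz
    simp only at h
    rw [h, hi, hray, quarter.neg_mul_cancel] at hc
    have he : (1 - (1 + (gridCoord i : ℝ) * I) : ℂ) = -(gridCoord i : ℝ) * I := by ring
    rw [he] at hc
    rcases σ.square_eq_double hσ d hmem hw hc with ⟨h3, h4, _⟩ | ⟨h3, h4, _⟩
    · subst h3
      have h5 : gridRay p (σ.side d) 1 = gridRay p' l 1 := by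
        rw [h4, hi, hray]; ring
      rcases gridRay_one_eq h5 with ⟨rfl, rfl⟩ | ⟨rfl, h6⟩
      · exact Or.inl ⟨rfl, hdir.unique σ hσ hb⟩
      · rw [hi] at h6
        exact absurd h6 (gridRay_gridSegment_two_ne _ _ _)
    · subst h3
      have h5 : gridRay q (σ.side d.symm) 1 = gridRay p' l 1 := by
        rw [h4, hj, hray, gridCoord_rev]; push_cast; ring
      rcases gridRay_one_eq h5 with ⟨rfl, rfl⟩ | ⟨rfl, h6⟩
      · refine Or.inr ⟨?_, rfl⟩
        have hback : σ.IsDirection (d.snd, q) (d.fst, p) (σ.side d.symm) :=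
          Or.inr ⟨d.symm, rfl, rfl, rfl, i.rev, hj, by rw [Fin.rev_rev, Dart.symm_symm]; exact hi⟩
        exact hback.unique σ hσ hb
      · rw [hj] at h6
        exact absurd h6 (gridRay_gridSegment_two_ne _ _ _)

end

end RotationSystem.SideChoice

/-! ### The drawing of the blow-up -/

namespace RotationSystem.SideChoice

open SimpleGraph Complex

variable {V : Type u} {G : SimpleGraph V} {R : RotationSystem G} (σ : R.SideChoice) {δ : ℕ}
  [Nonempty R.Surface]

/-- The drawing of the edge of the blow-up from `x` to `y`: a straight segment in the square of a
vertex or in the chart of a dart. -/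
noncomputable def segment (x y : V × (Fin δ × Fin δ)) (t : ℝ) : R.Surface :=
  open Classical in
  if x.1 = y.1 then σ.square x.1 ((1 - t) * gridPos x.2 + t * gridPos y.2)
  else if h : G.Adj x.1 y.1 then
    σ.double ⟨(x.1, y.1), h⟩ ((1 - t) * (1 - quarter (-σ.side ⟨(x.1, y.1), h⟩) * gridPos x.2) -
      t * (1 - quarter (-σ.side ⟨(y.1, x.1), h.symm⟩) * gridPos y.2))
  else Classical.arbitrary _

/-- The point lies on one of the lines on which the blow-up is drawn in the square of a vertex. -/
def OnGridLine (δ : ℕ) (z : ℂ) : Prop :=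
  z.re ∈ Set.range (gridCoord (δ := δ)) ∨ z.im ∈ Set.range (gridCoord (δ := δ))

theorem onGridLine_gridRay (p : Fin δ × Fin δ) (k : Fin 4) (r : ℝ) :
    OnGridLine δ (gridRay p k r) := by
  rcases quarter.cases k with h | h | h | h
  · exact Or.inr ⟨p.1, by rw [gridRay_im, h]; simp⟩
  · exact Or.inl ⟨p.2, by rw [gridRay_re, h]; simp⟩
  · exact Or.inr ⟨p.1, by rw [gridRay_im, h]; simp⟩
  · exact Or.inl ⟨p.2, by rw [gridRay_re, h]; simp⟩

theorem exists_abs_sub_gridCoord_le (hδ : 1 ≤ δ) {x : ℝ} (hx : |x| ≤ 1) :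
    ∃ i : Fin δ, |x - gridCoord i| ≤ 1 / δ := by
  have hδ' : (0 : ℝ) < δ := by exact_mod_cast hδ
  rw [abs_le] at hx
  have key : ∀ i : Fin δ, 2 * ((i : ℕ) : ℝ) ≤ δ * (x + 1) → δ * (x + 1) ≤ 2 * ((i : ℕ) : ℝ) + 2 →
      |x - gridCoord i| ≤ 1 / δ := by
    intro i h1 h2
    have h3 := gridCoord_mul i
    rw [abs_le, ← neg_div, div_le_iff₀ hδ', le_div_iff₀ hδ']
    constructor <;> nlinarith
  -- At the right end the floor would be `δ`, one past the last index.
  by_cases h1 : x = 1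
  · refine ⟨⟨δ - 1, by omega⟩, key _ ?_ ?_⟩ <;>
    · have : ((δ - 1 : ℕ) : ℝ) = δ - 1 := by rw [Nat.cast_sub hδ]; simp
      simp only [this, h1]; linarith
  · have h2 : 0 ≤ δ * (x + 1) / 2 := by
      have : 0 ≤ x + 1 := by linarith
      positivity
    have h3 : ⌊δ * (x + 1) / 2⌋₊ < δ := by
      rw [Nat.floor_lt h2]
      have : x < 1 := lt_of_le_of_ne hx.2 h1
      nlinarith
    refine ⟨⟨_, h3⟩, key _ ?_ ?_⟩
    · have := Nat.floor_le h2
      simp only; linarith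
    · have := (Nat.lt_floor_add_one (δ * (x + 1) / 2)).le
      simp only; linarith

theorem OnGridLine.exists_gridRay {z : ℂ} (h : OnGridLine δ z) (hz : z ∈ vertexSquare) :
    ∃ (p : Fin δ × Fin δ) (k : Fin 4) (r : ℝ), 0 ≤ r ∧ r ≤ 1 ∧ z = gridRay p k r := by
  have q3 : quarter 3 = -I := by simp [quarter, I_pow_three]
  have q2 : quarter 2 = -1 := by simp [quarter]
  rcases h with ⟨i, hi⟩ | ⟨i, hi⟩ <;> have hδ := i.cast_pos_real
  · obtain ⟨j, hj⟩ := exists_abs_sub_gridCoord_le i.pos hz.2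
    rw [le_div_iff₀ hδ] at hj
    rcases le_total 0 (z.im - gridCoord j) with h0 | h0
    · rw [abs_of_nonneg h0] at hj
      refine ⟨(j, i), 1, (z.im - gridCoord j) * δ, by positivity, hj, Complex.ext ?_ ?_⟩
      · rw [gridRay_re, quarter.one]; simp [hi]
      · rw [gridRay_im, quarter.one, mul_div_cancel_right₀ _ hδ.ne']; simp
    · rw [abs_of_nonpos h0] at hj
      refine ⟨(j, i), 3, -(z.im - gridCoord j) * δ, mul_nonneg (by linarith) hδ.le, hj,
        Complex.ext ?_ ?_⟩
      · rw [gridRay_re, q3]; simp [hi]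
      · rw [gridRay_im, q3, mul_div_cancel_right₀ _ hδ.ne']; simp
  · obtain ⟨j, hj⟩ := exists_abs_sub_gridCoord_le i.pos hz.1
    rw [le_div_iff₀ hδ] at hj
    rcases le_total 0 (z.re - gridCoord j) with h0 | h0
    · rw [abs_of_nonneg h0] at hj
      refine ⟨(i, j), 0, (z.re - gridCoord j) * δ, by positivity, hj, Complex.ext ?_ ?_⟩
      · rw [gridRay_re, quarter.zero, mul_div_cancel_right₀ _ hδ.ne']; simp
      · rw [gridRay_im, quarter.zero]; simp [hi]
    · rw [abs_of_nonpos h0] at hj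
      refine ⟨(i, j), 2, -(z.re - gridCoord j) * δ, mul_nonneg (by linarith) hδ.le, hj,
        Complex.ext ?_ ?_⟩
      · rw [gridRay_re, q2, mul_div_cancel_right₀ _ hδ.ne']; simp
      · rw [gridRay_im, q2]; simp [hi]

theorem segment_of_eq {x y : V × (Fin δ × Fin δ)} (h : x.1 = y.1) (t : ℝ) :
    σ.segment x y t = σ.square x.1 ((1 - t) * gridPos x.2 + t * gridPos y.2) := if_pos h

/-- The reversed index at the other end compensates the half turn between the two squares in the
chart, so the edge becomes horizontal, from `1 / δ` to `-1 / δ`. -/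
theorem segment_of_dart {x y : V × (Fin δ × Fin δ)} {d : G.Dart} {i : Fin δ} (hx : d.fst = x.1)
    (hy : d.snd = y.1) (hi : x.2 = gridSegment (σ.side d) i)
    (hj : y.2 = gridSegment (σ.side d.symm) i.rev) (t : ℝ) :
    σ.segment x y t = σ.double d (((1 - 2 * t) / δ : ℝ) - (gridCoord i : ℝ) * I) := by
  obtain ⟨u, p⟩ := x
  obtain ⟨v, q⟩ := y
  simp only at hx hy hi hj
  subst hx hy hi hj
  have h1 : σ.side ⟨(d.fst, d.snd), d.adj⟩ = σ.side d := rfl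
  have h2 : σ.side ⟨(d.snd, d.fst), d.adj.symm⟩ = σ.side d.symm := rfl
  refine (if_neg d.adj.ne).trans ((dif_pos d.adj).trans ?_)
  show σ.double d _ = _
  rw [h1, h2]
  congr 1
  simp only [gridPos_gridSegment, quarter.neg_mul_cancel, gridCoord_rev]
  push_cast
  ring

theorem segment_symm (hσ : Function.Bijective fun d : G.Dart => (d.fst, σ.side d))
    {x y : V × (Fin δ × Fin δ)} (h : (σ.blowUp δ).Adj x y) {t : ℝ} (h0 : 0 ≤ t) (h1 : t ≤ 1) :
    σ.segment y x t = σ.segment x y (1 - t) := by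
  obtain ⟨k, h | ⟨d, hx, hy, rfl, i, hi, hj⟩⟩ := σ.blowUp_adj_iff.mp h
  · rw [σ.segment_of_eq h.1, σ.segment_of_eq h.1.symm, h.1]
    congr 1
    push_cast
    ring
  · have hδ := i.cast_pos_real
    rw [σ.segment_of_dart hx hy hi hj, σ.segment_of_dart (d := d.symm) (i := i.rev) hy hx hj
      (by rw [Fin.rev_rev, Dart.symm_symm]; exact hi), σ.double_symm hσ, gridCoord_rev]
    · congr 1
      push_cast
      ring
    · have h2 : |(1 - 2 * t) / δ| ≤ 1 := by
        rw [abs_div, abs_of_pos hδ, div_le_one hδ]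
        have : (1 : ℝ) ≤ δ := by exact_mod_cast i.pos
        exact le_trans (abs_le.mpr ⟨by linarith, by linarith⟩) this
      have h3 := abs_gridCoord_lt i.rev
      refine ⟨?_, ?_⟩
      · simp only [sub_re, ofReal_re, re_ofReal_mul, I_re, mul_zero, sub_zero]
        linarith
      · simpa using h3

/-- Both kinds of edges begin with a ray in the square of their origin. All checks on the drawing
thereby reduce to rays of length at most `1 / δ`. -/
theorem segment_of_le_half {x y : V × (Fin δ × Fin δ)} {k : Fin 4}
    (h : σ.IsDirection x y k) {t : ℝ} (h1 : t ≤ 1 / 2) :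
    σ.segment x y t = σ.square x.1 (gridRay x.2 k (2 * t)) := by
  rcases h with ⟨h, h'⟩ | ⟨d, hx, hy, rfl, i, hi, hj⟩
  · rw [σ.segment_of_eq h, h', gridRay, gridRay]
    congr 1
    push_cast
    ring
  · have hδ := i.cast_pos_real
    rw [σ.segment_of_dart hx hy hi hj, σ.double_of_nonneg, hx, hi, gridRay, gridPos_gridSegment]
    · congr 1
      push_cast
      ring
    · simp only [sub_re, ofReal_re, re_ofReal_mul, I_re, mul_zero, sub_zero]
      exact div_nonneg (by linarith) hδ.le

theorem continuousOn_segment (hσ : Function.Bijective fun d : G.Dart => (d.fst, σ.side d))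
    [CompactSpace R.Surface] {x y : V × (Fin δ × Fin δ)} (h : (σ.blowUp δ).Adj x y) :
    ContinuousOn (σ.segment x y) (Set.Icc 0 1) := by
  obtain ⟨k, h | ⟨d, hx, hy, rfl, i, hi, hj⟩⟩ := σ.blowUp_adj_iff.mp h
  · rw [funext (σ.segment_of_eq h.1)]
    refine (σ.continuousOn_square hσ x.1).comp (by fun_prop) fun t ht => ?_
    have := convex_openSquare (gridPos_mem x.2) (gridPos_mem y.2) (sub_nonneg.mpr ht.2) ht.1
      (sub_add_cancel 1 t)
    simpa using this
  · rw [funext (σ.segment_of_dart hx hy hi hj)]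
    have hδ := i.cast_pos_real
    refine (σ.continuousOn_double hσ d).comp (by fun_prop) fun t ht => ?_
    have h2 : |(1 - 2 * t) / δ| ≤ 1 := by
      rw [abs_div, abs_of_pos hδ, div_le_one hδ]
      have : (1 : ℝ) ≤ δ := by exact_mod_cast i.pos
      exact le_trans (abs_le.mpr ⟨by linarith [ht.2], by linarith [ht.1]⟩) this
    have h3 := abs_gridCoord_lt i
    refine ⟨?_, ?_⟩
    · simp only [sub_re, ofReal_re, re_ofReal_mul, I_re, mul_zero, sub_zero]
      linarith
    · simpa using h3

section

variable (hσ : Function.Bijective fun d : G.Dart => (d.fst, σ.side d))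

omit [Nonempty R.Surface] in
/-- Every point of an edge lies, up to a reversal of the edge, on its first half. -/
theorem exists_half (a : (σ.blowUp δ).Dart) {t : ℝ} (h0 : 0 ≤ t) (h1 : t ≤ 1) :
    ∃ (b : (σ.blowUp δ).Dart) (k : Fin 4) (s : ℝ), σ.IsDirection b.fst b.snd k ∧
      0 ≤ s ∧ s ≤ 1 / 2 ∧ ((b = a ∧ s = t) ∨ (b = a.symm ∧ s = 1 - t)) := by
  rcases le_total t (1 / 2) with h | h
  · obtain ⟨k, hk⟩ := σ.blowUp_adj_iff.mp a.adj
    exact ⟨a, k, t, hk, h0, h, Or.inl ⟨rfl, rfl⟩⟩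
  · obtain ⟨k, hk⟩ := σ.blowUp_adj_iff.mp a.adj.symm
    exact ⟨a.symm, k, 1 - t, hk, by linarith, by linarith, Or.inr ⟨rfl, rfl⟩⟩

include hσ

theorem segment_eq_of_half {a b : (σ.blowUp δ).Dart} {k : Fin 4} {s t : ℝ}
    (hk : σ.IsDirection b.fst b.snd k) (h0 : 0 ≤ s) (hs : s ≤ 1 / 2)
    (h : (b = a ∧ s = t) ∨ (b = a.symm ∧ s = 1 - t)) :
    σ.segment a.fst a.snd t = σ.square b.fst.1 (gridRay b.fst.2 k (2 * s)) := by
  rw [← σ.segment_of_le_half hk hs]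
  rcases h with ⟨rfl, rfl⟩ | ⟨rfl, rfl⟩
  · rfl
  · exact (σ.segment_symm hσ a.adj h0 (by linarith)).symm ▸ by rw [sub_sub_cancel]

/-- The drawing of the blow-up on the surface of the rotation system. -/
noncomputable def embedding [CompactSpace R.Surface] (δ : ℕ) :
    GraphEmbedding (σ.blowUp δ) R.Surface where
  point x := σ.square x.1 (gridPos x.2)
  arc a :=
    { toFun := fun t => σ.segment a.fst a.snd t
      continuous_toFun := (σ.continuousOn_segment hσ a.adj).domRestrict
      source' := by
        obtain ⟨k, hk⟩ := σ.blowUp_adj_iff.mp a.adj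
        rw [Set.Icc.coe_zero, σ.segment_of_le_half hk (by norm_num), mul_zero, gridRay_zero]
      target' := by
        obtain ⟨k, hk⟩ := σ.blowUp_adj_iff.mp a.adj.symm
        rw [Set.Icc.coe_one, σ.segment_symm hσ a.adj.symm zero_le_one le_rfl, sub_self,
          σ.segment_of_le_half hk (by norm_num), mul_zero, gridRay_zero] }
  arc_symm a := by
    ext t
    exact σ.segment_symm hσ a.adj t.2.1 t.2.2
  point_injective x y h := by
    obtain ⟨h1, h2⟩ := σ.square_inj hσ (gridPos_mem _) (openSquare_subset (gridPos_mem _)) h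
    exact Prod.ext h1 (gridPos_injective h2)
  arc_injective a := by
    intro t t' h
    obtain ⟨b, k, s, hk, h0, hs, hb⟩ := σ.exists_half a t.2.1 t.2.2
    obtain ⟨b', k', s', hk', h0', hs', hb'⟩ := σ.exists_half a t'.2.1 t'.2.2
    replace h : σ.segment a.fst a.snd t = σ.segment a.fst a.snd t' := h
    rw [σ.segment_eq_of_half hσ hk h0 hs hb, σ.segment_eq_of_half hσ hk' h0' hs' hb'] at h
    -- As soon as one of the points precedes the midpoint, disjointness of the rays identifies the
    -- origins and the parameters.
    have key : s = 1 / 2 ∧ s' = 1 / 2 ∨ b.fst = b'.fst ∧ s = s' := by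
      by_cases h1 : s < 1 / 2
      · obtain ⟨e1, e2, _⟩ := σ.gridRay_square_inj hσ (by linarith) (by linarith) (by linarith)
          (by linarith) h
        exact Or.inr ⟨e1, by linarith⟩
      · by_cases h2 : s' < 1 / 2
        · obtain ⟨e1, e2, _⟩ := σ.gridRay_square_inj hσ (by linarith) (by linarith) (by linarith)
            (by linarith) h.symm
          exact Or.inr ⟨e1.symm, by linarith⟩
        · exact Or.inl ⟨by linarith, by linarith⟩
    apply Subtype.ext
    have hne := a.adj.ne
    rcases key with ⟨e1, e2⟩ | ⟨e1, e2⟩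
    · rcases hb with ⟨_, hb⟩ | ⟨_, hb⟩ <;> rcases hb' with ⟨_, hb'⟩ | ⟨_, hb'⟩ <;> linarith
    · rcases hb with ⟨rfl, hb⟩ | ⟨rfl, hb⟩ <;> rcases hb' with ⟨rfl, hb'⟩ | ⟨rfl, hb'⟩
      · linarith
      · exact absurd e1 hne
      · exact absurd e1.symm hne
      · linarith
  arc_ne_point a t x h := by
    obtain ⟨b, k, s, hk, h0, hs, hb⟩ := σ.exists_half a t.2.1 t.2.2
    replace h : σ.segment a.fst a.snd t = σ.square x.1 (gridPos x.2) := h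
    rw [σ.segment_eq_of_half hσ hk h0 hs hb, ← gridRay_zero _ 0] at h
    -- A vertex is a ray of length zero, so it meets another ray only at its origin.
    obtain ⟨_, e2, _⟩ := σ.gridRay_square_inj hσ le_rfl zero_lt_one (by linarith)
      (by linarith) h.symm
    rcases hb with ⟨_, hb⟩ | ⟨_, hb⟩
    · exact Or.inl (Subtype.ext (by rw [Set.Icc.coe_zero]; linarith))
    · exact Or.inr (Subtype.ext (by rw [Set.Icc.coe_one]; linarith))
  edge_eq_of_arc_eq a a' t t' ht0 ht1 ht0' ht1' h := by
    have pos : ∀ t : unitInterval, t ≠ 0 → (0 : ℝ) < t := fun t h =>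
      lt_of_le_of_ne t.2.1 fun e => h (Subtype.ext e.symm)
    have lt1 : ∀ t : unitInterval, t ≠ 1 → (t : ℝ) < 1 := fun t h =>
      lt_of_le_of_ne t.2.2 fun e => h (Subtype.ext e)
    have ht0 := pos t ht0
    have ht1 := lt1 t ht1
    have ht0' := pos t' ht0'
    have ht1' := lt1 t' ht1'
    obtain ⟨b, k, s, hk, h0, hs, hb⟩ := σ.exists_half a t.2.1 t.2.2
    obtain ⟨b', k', s', hk', h0', hs', hb'⟩ := σ.exists_half a' t'.2.1 t'.2.2
    replace h : σ.segment a.fst a.snd t = σ.segment a'.fst a'.snd t' := h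
    rw [σ.segment_eq_of_half hσ hk h0 hs hb, σ.segment_eq_of_half hσ hk' h0' hs' hb'] at h
    have hs0 : 0 < s := by rcases hb with ⟨_, hb⟩ | ⟨_, hb⟩ <;> linarith
    have hs0' : 0 < s' := by rcases hb' with ⟨_, hb⟩ | ⟨_, hb⟩ <;> linarith
    have hab : b.edge = a.edge := by
      rcases hb with ⟨rfl, _⟩ | ⟨rfl, _⟩
      · rfl
      · exact Dart.edge_symm _
    have hab' : b'.edge = a'.edge := by
      rcases hb' with ⟨rfl, _⟩ | ⟨rfl, _⟩
      · rfl
      · exact Dart.edge_symm _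
    rw [← hab, ← hab', dart_edge_eq_iff]
    have same : ∀ {c c' : (σ.blowUp δ).Dart} {m m' : Fin 4}, σ.IsDirection c.fst c.snd m →
        σ.IsDirection c'.fst c'.snd m' → c.fst = c'.fst → m = m' → c = c' := by
      intro c c' m m' h1 h2 h3 h4
      rw [h3, h4] at h1
      exact Dart.ext _ _ (Prod.ext h3 (h1.unique σ hσ h2))
    by_cases h1 : s < 1 / 2
    · obtain ⟨e1, _, e2⟩ := σ.gridRay_square_inj hσ (by linarith) (by linarith) (by linarith)
        (by linarith) h
      exact Or.inl (same hk hk' e1 (e2 (by linarith)))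
    · by_cases h2 : s' < 1 / 2
      · obtain ⟨e1, _, e2⟩ := σ.gridRay_square_inj hσ (by linarith) (by linarith) (by linarith)
          (by linarith) h.symm
        exact Or.inl (same hk' hk e1 (e2 (by linarith))).symm
      · have e1 : 2 * s = 1 := by linarith
        have e2 : 2 * s' = 1 := by linarith
        rw [e1, e2] at h
        rcases σ.eq_or_eq_of_midpoint hσ hk hk' h with ⟨h3, h4⟩ | ⟨h3, h4⟩
        · exact Or.inl (Dart.ext _ _ (Prod.ext h3 h4))
        · exact Or.inr (Dart.ext _ _ (Prod.ext h3 h4))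

/-- Every point of a line is within `1 / δ` of a grid point on it, hence on a ray, and every ray is
the first half of an edge by `exists_isDirection`. -/
theorem mem_image_embedding [CompactSpace R.Surface] {p : R.Surface} :
    p ∈ (σ.embedding hσ δ).image ↔
      ∃ v, ∃ z ∈ vertexSquare, OnGridLine δ z ∧ σ.square v z = p := by
  constructor
  · rintro (⟨x, rfl⟩ | hp)
    · exact ⟨x.1, _, openSquare_subset (gridPos_mem x.2), Or.inl ⟨_, rfl⟩, rfl⟩
    · rw [Set.mem_iUnion] at hp
      obtain ⟨a, t, rfl⟩ := hp
      obtain ⟨b, k, s, hk, h0, hs, hb⟩ := σ.exists_half a t.2.1 t.2.2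
      exact ⟨_, _, gridRay_mem_vertexSquare _ _ (by linarith) (by linarith),
        onGridLine_gridRay _ _ _, (σ.segment_eq_of_half hσ hk h0 hs hb).symm⟩
  · rintro ⟨v, z, hz, hline, rfl⟩
    obtain ⟨p, k, r, h0, h1, rfl⟩ := hline.exists_gridRay hz
    obtain ⟨y, hy⟩ := σ.exists_isDirection hσ (v, p) k
    refine Or.inr (Set.mem_iUnion.mpr ⟨⟨((v, p), y), σ.blowUp_adj_iff.mpr ⟨k, hy⟩⟩,
      ⟨r / 2, by linarith, by linarith⟩, ?_⟩)
    refine (σ.segment_of_le_half hy (t := r / 2) (by linarith)).trans ?_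
    rw [mul_div_cancel₀ _ (two_ne_zero)]

end

end RotationSystem.SideChoice

/-! ### Recognising components and disks -/

/-- The set `P` is open and equals `K ∩ A`, so it is clopen in `A`. -/
theorem connectedComponentIn_eq_of_isOpen {X : Type*} [TopologicalSpace X] {A P K : Set X} {x : X}
    (hPo : IsOpen P) (hPc : IsPreconnected P) (hPA : P ⊆ A) (hK : IsClosed K) (hPK : P ⊆ K)
    (hKA : K ∩ A ⊆ P) (hx : x ∈ P) : connectedComponentIn A x = P := by
  refine Set.Subset.antisymm ?_ (hPc.subset_connectedComponentIn hx hPA)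
  refine isPreconnected_connectedComponentIn.subset_left_of_subset_union hPo hK.isOpen_compl ?_ ?_
    ⟨x, mem_connectedComponentIn (hPA hx), hx⟩
  · exact Set.disjoint_left.mpr fun y hy hy' => hy' (hPK hy)
  · intro y hy
    by_cases hyK : y ∈ K
    · exact Or.inl (hKA ⟨hyK, connectedComponentIn_subset _ _ hy⟩)
    · exact Or.inr hyK

theorem nonempty_homeomorph_ball {O : Set ℂ} (hO : IsOpen O) (hc : Convex ℝ O)
    (hne : O.Nonempty) (hb : Bornology.IsBounded O) :
    Nonempty (O ≃ₜ Metric.ball (0 : EuclideanSpace ℝ (Fin 2)) 1) := by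
  obtain ⟨h, h1, _, _⟩ := exists_homeomorph_image_interior_closure_frontier_eq_unitBall hc
    (by rwa [hO.interior_eq]) hb
  rw [hO.interior_eq] at h1
  let e := Complex.orthonormalBasisOneI.repr
  have h2 : e.toHomeomorph '' Metric.ball 0 1 = Metric.ball (0 : EuclideanSpace ℝ (Fin 2)) 1 := by
    have := e.image_ball 0 1
    rwa [map_zero] at this
  exact ⟨(h.image O).trans ((Homeomorph.setCongr h1).trans
    ((e.toHomeomorph.image _).trans (Homeomorph.setCongr h2)))⟩

/-! ### Gaps between consecutive lines -/

section

variable {δ : ℕ}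

theorem neg_mem_range_gridCoord {x : ℝ} :
    -x ∈ Set.range (gridCoord (δ := δ)) ↔ x ∈ Set.range (gridCoord (δ := δ)) := by
  constructor
  · rintro ⟨i, hi⟩
    exact ⟨i.rev, by rw [gridCoord_rev, hi, neg_neg]⟩
  · rintro ⟨i, rfl⟩
    exact ⟨i.rev, gridCoord_rev i⟩

/-- The lines of the grids in adjacent squares, at an odd multiple of `1 / δ` from their common
side. -/
theorem one_sub_abs_mem_range_gridCoord (hδ : 1 ≤ δ) {x : ℝ} :
    1 - |x| ∈ Set.range (gridCoord (δ := δ)) ↔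
      ∃ n : ℤ, δ * x = 2 * n + 1 ∧ |δ * x| ≤ 2 * δ - 1 := by
  have hδ' : (0 : ℝ) < δ := by exact_mod_cast hδ
  constructor
  · rintro ⟨i, hi⟩
    have h := gridCoord_mul i
    rw [hi] at h
    have h1 : δ * |x| = 2 * (δ - 1 - (i : ℕ)) + 1 := by linarith
    have h2 : |δ * x| ≤ 2 * δ - 1 := by
      rw [abs_mul, abs_of_pos hδ', h1]
      have : (0 : ℝ) ≤ (i : ℕ) := Nat.cast_nonneg _
      linarith
    rcases abs_choice x with h3 | h3 <;> rw [h3] at h1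
    · exact ⟨δ - 1 - (i : ℕ), by push_cast; exact h1, h2⟩
    · exact ⟨-(δ - 1 - (i : ℕ)) - 1, by push_cast; linarith, h2⟩
  · rintro ⟨n, h1, h2⟩
    have key : ∀ m : ℤ, 0 ≤ 2 * m + 1 → (δ : ℝ) * |x| = 2 * m + 1 →
        1 - |x| ∈ Set.range (gridCoord (δ := δ)) := by
      intro m h0 hm
      rw [abs_mul, abs_of_pos hδ', hm] at h2
      have h3 : 2 * m + 1 ≤ 2 * (δ : ℤ) - 1 := by exact_mod_cast h2
      obtain ⟨k, rfl⟩ := Int.eq_ofNat_of_zero_le (by omega : 0 ≤ m)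
      have hk : k < δ := by omega
      refine ⟨Fin.rev ⟨k, hk⟩, ?_⟩
      have h4 := gridCoord_mul (⟨k, hk⟩ : Fin δ)
      rw [gridCoord_rev]
      apply mul_left_cancel₀ hδ'.ne'
      push_cast at hm
      simp only at h4
      rw [mul_neg, h4]
      linarith
    rcases le_total 0 x with hx | hx
    · rw [abs_of_nonneg hx] at key ⊢
      refine key n ?_ h1
      have : (0 : ℝ) ≤ 2 * n + 1 := by rw [← h1]; positivity
      exact_mod_cast this
    · rw [abs_of_nonpos hx] at key ⊢
      refine key (-n - 1) ?_ (by push_cast; linarith)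
      have : (2 * n + 1 : ℝ) ≤ 0 := by rw [← h1]; exact mul_nonpos_of_nonneg_of_nonpos hδ'.le hx
      have : 2 * n + 1 ≤ (0 : ℤ) := by exact_mod_cast this
      omega

/-- In two adjacent squares the lines parallel to the common side are at odd multiples of `1 / δ`,
without irregularity at the side itself. The floor finds the consecutive odd numbers around `δ * x`.
-/
theorem exists_between_odd (hδ : 1 ≤ δ) {x : ℝ} (hx : |x| < 2 - 1 / δ)
    (hne : 1 - |x| ∉ Set.range (gridCoord (δ := δ))) :
    ∃ a b : ℝ, a < x ∧ x < b ∧ -2 < a ∧ b < 2 ∧ 1 - |a| ∈ Set.range (gridCoord (δ := δ)) ∧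
      1 - |b| ∈ Set.range (gridCoord (δ := δ)) ∧
      ∀ y, a < y → y < b → 1 - |y| ∉ Set.range (gridCoord (δ := δ)) := by
  have hδ' : (0 : ℝ) < δ := by exact_mod_cast hδ
  have hx' : |δ * x| < 2 * δ - 1 := by
    rw [abs_mul, abs_of_pos hδ']
    have := mul_lt_mul_of_pos_left hx hδ'
    rwa [mul_sub, mul_one_div_cancel hδ'.ne', mul_comm (δ : ℝ) 2] at this
  rw [one_sub_abs_mem_range_gridCoord hδ] at hne
  set n := ⌊(δ * x - 1) / 2⌋ with hn
  have h1 := Int.floor_le ((δ * x - 1) / 2)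
  have h2 := Int.lt_floor_add_one ((δ * x - 1) / 2)
  rw [← hn] at h1 h2
  have h3 : (2 * n + 1 : ℝ) < δ * x := by
    refine lt_of_le_of_ne (by linarith) fun e => hne ⟨n, e.symm, hx'.le⟩
  have h4 : δ * x < 2 * n + 3 := by linarith
  rw [abs_lt] at hx'
  have h5 : n ≤ (δ : ℤ) - 2 := by
    have : (2 * n + 1 : ℝ) < 2 * δ - 1 := by linarith
    have : 2 * n + 1 < 2 * (δ : ℤ) - 1 := by exact_mod_cast this
    omega
  have h6 : -(δ : ℤ) ≤ n := by
    have : (-(2 * δ - 1) : ℝ) < 2 * n + 3 := by linarith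
    have : -(2 * (δ : ℤ) - 1) < 2 * n + 3 := by exact_mod_cast this
    omega
  have h5' : (n : ℝ) ≤ δ - 2 := by exact_mod_cast h5
  have h6' : -(δ : ℝ) ≤ n := by exact_mod_cast h6
  refine ⟨(2 * n + 1) / δ, (2 * n + 3) / δ, ?_, ?_, ?_, ?_, ?_, ?_, ?_⟩
  · rw [div_lt_iff₀ hδ']; linarith
  · rw [lt_div_iff₀ hδ']; linarith
  · rw [lt_div_iff₀ hδ']; linarith
  · rw [div_lt_iff₀ hδ']; linarith
  · rw [one_sub_abs_mem_range_gridCoord hδ, mul_div_cancel₀ _ hδ'.ne', abs_le]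
    exact ⟨n, rfl, by linarith, by linarith⟩
  · rw [one_sub_abs_mem_range_gridCoord hδ, mul_div_cancel₀ _ hδ'.ne', abs_le]
    exact ⟨n + 1, by push_cast; ring, by linarith, by linarith⟩
  · intro y hy1 hy2
    rw [one_sub_abs_mem_range_gridCoord hδ]
    rintro ⟨m, hm, _⟩
    rw [div_lt_iff₀ hδ', mul_comm y, hm] at hy1
    rw [lt_div_iff₀ hδ', mul_comm y, hm] at hy2
    have e1 : 2 * n + 1 < 2 * m + 1 := by exact_mod_cast hy1
    have e2 : 2 * m + 1 < 2 * n + 3 := by exact_mod_cast hy2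
    omega

/-- In the transverse direction only one square is available; the bound on `x` keeps it between the
first and the last line. -/
theorem exists_between_gridCoord (hδ : 1 ≤ δ) {x : ℝ} (hx : |x| < 1 - 1 / δ)
    (hne : x ∉ Set.range (gridCoord (δ := δ))) :
    ∃ i j : Fin δ, gridCoord i < x ∧ x < gridCoord j ∧
      ∀ y, gridCoord i < y → y < gridCoord j → y ∉ Set.range (gridCoord (δ := δ)) := by
  have hδ' : (0 : ℝ) < δ := by exact_mod_cast hδ
  have hx' : |δ * x| < δ - 1 := by
    rw [abs_mul, abs_of_pos hδ']
    have := mul_lt_mul_of_pos_left hx hδ'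
    rwa [mul_sub, mul_one_div_cancel hδ'.ne', mul_one] at this
  rw [abs_lt] at hx'
  have h0 : 0 ≤ (δ * x + δ - 1) / 2 := by linarith
  set n := ⌊(δ * x + δ - 1) / 2⌋₊ with hn
  have h1 := Nat.floor_le h0
  have h2 := Nat.lt_floor_add_one ((δ * x + δ - 1) / 2)
  rw [← hn] at h1 h2
  have h3 : n + 1 < δ := by
    have : (n : ℝ) < δ - 1 := by linarith
    have : (n : ℝ) + 1 < δ := by linarith
    exact_mod_cast this
  have hi := gridCoord_mul (⟨n, by omega⟩ : Fin δ)
  have hj := gridCoord_mul (⟨n + 1, h3⟩ : Fin δ)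
  simp only [Nat.cast_add, Nat.cast_one] at hi hj
  refine ⟨⟨n, by omega⟩, ⟨n + 1, h3⟩, ?_, ?_, ?_⟩
  · refine lt_of_le_of_ne ?_ fun e => hne ⟨_, e⟩
    refine le_of_mul_le_mul_left ?_ hδ'
    rw [hi]; linarith
  · refine lt_of_mul_lt_mul_left ?_ hδ'.le
    rw [hj]; linarith
  · rintro y hy1 hy2 ⟨k, rfl⟩
    have e1 := mul_lt_mul_of_pos_left hy1 hδ'
    have e2 := mul_lt_mul_of_pos_left hy2 hδ'
    rw [gridCoord_mul k] at e1 e2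
    rw [hi] at e1
    rw [hj] at e2
    have e3 : (n : ℝ) < (k : ℕ) := by linarith
    have e4 : ((k : ℕ) : ℝ) < n + 1 := by linarith
    have e5 : n < (k : ℕ) := by exact_mod_cast e3
    have e6 : (k : ℕ) < n + 1 := by exact_mod_cast e4
    omega

end

/-! ### Rectangular faces -/

namespace RotationSystem.SideChoice

open SimpleGraph Complex

variable {V : Type u} {G : SimpleGraph V} {R : RotationSystem G} (σ : R.SideChoice) {δ : ℕ}

theorem onGridLine_quarter_mul (k : Fin 4) {z : ℂ} :
    OnGridLine δ (quarter k * z) ↔ OnGridLine δ z := by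
  have := neg_mem_range_gridCoord (δ := δ) (x := z.re)
  have := neg_mem_range_gridCoord (δ := δ) (x := z.im)
  rcases quarter.cases k with h | h | h | h <;> rw [h] <;>
    simp only [OnGridLine, one_mul, neg_mul, I_mul_re, I_mul_im, neg_re, neg_im, neg_neg] <;> tauto

variable [Nonempty R.Surface] (hσ : Function.Bijective fun d : G.Dart => (d.fst, σ.side d))
  [CompactSpace R.Surface]

include hσ

/-- In both squares `|w.re|` is the distance from the common side, and the lines are symmetric about
the axes, so one condition serves both. -/
theorem double_mem_image_iff (d : G.Dart) {w : ℂ} (hw : w ∈ doubleSquare) :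
    σ.double d w ∈ (σ.embedding hσ δ).image ↔
      1 - |w.re| ∈ Set.range (gridCoord (δ := δ)) ∨ w.im ∈ Set.range (gridCoord (δ := δ)) := by
  have him := neg_mem_range_gridCoord (δ := δ) (x := w.im)
  rw [σ.mem_image_embedding hσ]
  constructor
  · rintro ⟨v, z, hz, hline, h⟩
    have hc := σ.chart_double hσ d hw
    rw [← h] at hc
    rcases σ.square_eq_double hσ d hz hw hc with ⟨rfl, rfl, h1⟩ | ⟨rfl, rfl, h1⟩ <;>
      rw [onGridLine_quarter_mul] at hline
    · rw [abs_of_nonneg h1]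
      simpa [OnGridLine, him] using hline
    · rw [abs_of_nonpos h1]
      simpa [OnGridLine] using hline
  · intro h
    rcases le_total 0 w.re with h1 | h1
    · rw [abs_of_nonneg h1] at h
      refine ⟨_, _, quarter_mul_mem_vertexSquare _ (one_sub_mem_vertexSquare hw h1), ?_,
        (σ.double_of_nonneg d h1).symm⟩
      rw [onGridLine_quarter_mul]
      simpa [OnGridLine, him] using h
    · rw [abs_of_nonpos h1] at h
      refine ⟨_, _, quarter_mul_mem_vertexSquare _ (one_add_mem_vertexSquare hw h1), ?_,
        (σ.double_of_nonpos hσ d h1 hw).symm⟩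
      rw [onGridLine_quarter_mul]
      simpa [OnGridLine] using h

/-- The faces of the drawing of the blow-up that do not contain a corner of a square are
rectangles in the chart of a dart. -/
theorem nonempty_homeomorph_of_double [T2Space R.Surface] (hδ : 1 ≤ δ) (d : G.Dart) {w : ℂ}
    (hre : |w.re| < 2 - 1 / δ) (him : |w.im| < 1 - 1 / δ)
    (hw : σ.double d w ∉ (σ.embedding hσ δ).image) :
    Nonempty (connectedComponentIn (σ.embedding hσ δ).imageᶜ (σ.double d w) ≃ₜ
      Metric.ball (0 : EuclideanSpace ℝ (Fin 2)) 1) := by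
  have hδ' : (0 : ℝ) < 1 / δ := by
    have : (0 : ℝ) < δ := by exact_mod_cast hδ
    positivity
  have hwT : w ∈ doubleSquare := ⟨by linarith, by linarith⟩
  rw [σ.double_mem_image_iff hσ d hwT, not_or] at hw
  obtain ⟨a, b, ha, hb, ha2, hb2, hal, hbl, hab⟩ := exists_between_odd hδ hre hw.1
  obtain ⟨i, j, hi, hj, hij⟩ := exists_between_gridCoord hδ him hw.2
  have hi1 := (abs_lt.mp (abs_gridCoord_lt i)).1
  have hj1 := (abs_lt.mp (abs_gridCoord_lt j)).2
  set O : Set ℂ := Set.Ioo a b ×ℂ Set.Ioo (gridCoord i) (gridCoord j) with hO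
  set K : Set ℂ := Set.Icc a b ×ℂ Set.Icc (gridCoord i) (gridCoord j) with hK
  have hOK : O ⊆ K := fun z hz => ⟨Set.Ioo_subset_Icc_self hz.1, Set.Ioo_subset_Icc_self hz.2⟩
  have hKT : K ⊆ doubleSquare := by
    rintro z ⟨⟨h1, h2⟩, h3, h4⟩
    exact ⟨abs_lt.mpr ⟨by linarith, by linarith⟩, abs_lt.mpr ⟨by linarith, by linarith⟩⟩
  have hOo : IsOpen O := isOpen_Ioo.reProdIm isOpen_Ioo
  have hOc : Convex ℝ O := ((convex_Ioo a b).linear_preimage Complex.reLm).inter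
    ((convex_Ioo _ _).linear_preimage Complex.imLm)
  have hKc : IsCompact K := isCompact_Icc.reProdIm isCompact_Icc
  have hwO : w ∈ O := ⟨⟨ha, hb⟩, hi, hj⟩
  have hcont := σ.continuousOn_double hσ d
  -- The boundary of the closed rectangle lies on lines of the drawing, so its trace on the
  -- complement is the open rectangle.
  have hcomp : connectedComponentIn (σ.embedding hσ δ).imageᶜ (σ.double d w) =
      σ.double d '' O := by
    refine connectedComponentIn_eq_of_isOpen (K := σ.double d '' K)
      (σ.isOpen_double_image hσ d hOo (hOK.trans hKT))
      (hOc.isPreconnected.image _ (hcont.mono (hOK.trans hKT))) ?_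
      (hKc.image_of_continuousOn (hcont.mono hKT)).isClosed (Set.image_mono hOK) ?_
      ⟨w, hwO, rfl⟩
    · rintro _ ⟨z, hz, rfl⟩
      rw [Set.mem_compl_iff, σ.double_mem_image_iff hσ d (hKT (hOK hz)), not_or]
      exact ⟨hab _ hz.1.1 hz.1.2, hij _ hz.2.1 hz.2.2⟩
    · rintro _ ⟨⟨z, hz, rfl⟩, hzA⟩
      rw [Set.mem_compl_iff, σ.double_mem_image_iff hσ d (hKT hz), not_or] at hzA
      refine ⟨z, ⟨⟨lt_of_le_of_ne hz.1.1 ?_, lt_of_le_of_ne hz.1.2 ?_⟩,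
        lt_of_le_of_ne hz.2.1 ?_, lt_of_le_of_ne hz.2.2 ?_⟩, rfl⟩
      · rintro e; exact hzA.1 (e ▸ hal)
      · rintro e; exact hzA.1 (e ▸ hbl)
      · rintro e; exact hzA.2 ⟨i, e⟩
      · rintro e; exact hzA.2 ⟨j, e.symm⟩
  rw [hcomp]
  obtain ⟨e⟩ := nonempty_homeomorph_ball hOo hOc ⟨w, hwO⟩ (hKc.isBounded.subset hOK)
  exact ⟨(σ.doubleHomeomorph hσ d hOo (hOK.trans hKT)).symm.trans e⟩

end RotationSystem.SideChoice

/-! ### Faces around the centres of the faces of `G` -/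

namespace RotationSystem

open SimpleGraph

variable {V : Type u} {G : SimpleGraph V} (R : RotationSystem G)

/-- Two darts lie, with the corners that they start, on a common face. -/
def SameFace (d e : G.Dart) : Prop :=
  Relation.EqvGen (fun a b => R.next b = a.symm) d e

variable {R}

/-- A neighbourhood of the centre of the face of `d`; the whole face for `ε = 0`. -/
def facePart (d : G.Dart) {ε : ℝ} (h0 : 0 ≤ ε) (h1 : ε < 1) : Set R.Surface :=
  {p | Quot.lift (fun c : R.Corners => R.SameFace d c.1 ∧ ε < c.2.1 ∧ ε < c.2.2)
    (fun _ _ h => by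
      cases h with
      -- Points of half-edges have a zero coordinate and are excluded because `0 ≤ ε`; gluings of
      -- the other kind stay within a face.
      | halfEdge d' t => simp [h0.not_gt]
      | face a b h t =>
        have hab : R.SameFace d a ↔ R.SameFace d b :=
          ⟨fun hd => hd.trans _ _ _ (.rel _ _ h), fun hd => hd.trans _ _ _ (.symm _ _ (.rel _ _ h))⟩
        simp [h1, hab]) p}

section

variable {d : G.Dart} {ε : ℝ} {h0 : 0 ≤ ε} {h1 : ε < 1}

theorem mk_mem_facePart {c : R.Corners} :
    Quot.mk R.Glue c ∈ facePart d h0 h1 ↔ R.SameFace d c.1 ∧ ε < c.2.1 ∧ ε < c.2.2 := Iff.rfl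

theorem SameFace.mk_one_eq {e : G.Dart} (h : R.SameFace d e) :
    Quot.mk R.Glue ⟨d, (1, 1)⟩ = Quot.mk R.Glue ⟨e, (1, 1)⟩ := by
  induction h with
  | rel a b h => exact Quot.sound (Glue.face a b h 1)
  | refl _ => rfl
  | symm _ _ _ ih => exact ih.symm
  | trans _ _ _ _ _ ih ih' => exact ih.trans ih'

theorem continuous_mk_corner (e : G.Dart) :
    Continuous fun q : unitInterval × unitInterval => Quot.mk R.Glue ⟨e, q⟩ :=
  continuous_quot_mk.comp continuous_sigmaMk

theorem isOpen_facePart : IsOpen (facePart (R := R) d h0 h1) := by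
  rw [← isQuotientMap_quot_mk.isOpen_preimage, isOpen_sigma_iff]
  intro e
  have h : Sigma.mk e ⁻¹' (Quot.mk R.Glue ⁻¹' facePart d h0 h1) =
      {_q : unitInterval × unitInterval | R.SameFace d e} ∩
        ({q | ε < (q.1 : ℝ)} ∩ {q | ε < (q.2 : ℝ)}) := rfl
  rw [h]
  exact isOpen_const.inter ((isOpen_lt (by fun_prop) (by fun_prop)).inter
    (isOpen_lt (by fun_prop) (by fun_prop)))

/-- The pieces of all corners of a face contain its centre. -/
theorem isPreconnected_facePart : IsPreconnected (facePart (R := R) d h0 h1) := by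
  have h : facePart (R := R) d h0 h1 = ⋃ e : {e // R.SameFace d e},
      (fun q : unitInterval × unitInterval => Quot.mk R.Glue ⟨e.1, q⟩) ''
        (Set.Ioc ⟨ε, h0, h1.le⟩ 1 ×ˢ Set.Ioc ⟨ε, h0, h1.le⟩ 1) := by
    ext p
    obtain ⟨⟨e, x, y⟩, rfl⟩ := Quot.exists_rep p
    rw [Set.mem_iUnion]
    constructor
    · rintro ⟨hd, hx, hy⟩
      exact ⟨⟨e, hd⟩, (x, y), ⟨⟨hx, x.2.2⟩, ⟨hy, y.2.2⟩⟩, rfl⟩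
    · rintro ⟨e', ⟨x', y'⟩, ⟨⟨hx, _⟩, ⟨hy, _⟩⟩, h⟩
      rw [← h, mk_mem_facePart]
      exact ⟨e'.2, hx, hy⟩
  rw [h]
  refine isPreconnected_iUnion ⟨Quot.mk R.Glue ⟨d, (1, 1)⟩, Set.mem_iInter.mpr fun e => ?_⟩
    fun e => ?_
  · exact ⟨(1, 1), ⟨⟨h1, le_rfl⟩, ⟨h1, le_rfl⟩⟩, e.2.mk_one_eq.symm⟩
  · exact (isPreconnected_Ioc.prod isPreconnected_Ioc).image _
      (continuous_mk_corner e.1).continuousOn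

/-- The closed version of the part adds only points with a coordinate equal to `ε`, which `A`
avoids. It is closed as the image of a compact set, there being finitely many corners. -/
theorem connectedComponentIn_eq_facePart [Finite G.Dart] [T2Space R.Surface] {A : Set R.Surface}
    (hA : facePart d h0 h1 ⊆ A)
    (hA' : ∀ c : R.Corners, Quot.mk R.Glue c ∈ A → (c.2.1 : ℝ) ≠ ε ∧ (c.2.2 : ℝ) ≠ ε)
    {p : R.Surface} (hp : p ∈ facePart d h0 h1) :
    connectedComponentIn A p = facePart d h0 h1 := by
  refine connectedComponentIn_eq_of_isOpen
    (K := Quot.mk R.Glue '' {c | R.SameFace d c.1 ∧ ε ≤ c.2.1 ∧ ε ≤ c.2.2})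
    isOpen_facePart isPreconnected_facePart hA ?_ ?_ ?_ hp
  · refine (IsClosed.isCompact ?_ |>.image continuous_quot_mk).isClosed
    rw [isClosed_sigma_iff]
    intro e
    have h : Sigma.mk e ⁻¹' {c : R.Corners | R.SameFace d c.1 ∧ ε ≤ c.2.1 ∧ ε ≤ c.2.2} =
        {_q : unitInterval × unitInterval | R.SameFace d e} ∩
          ({q | ε ≤ (q.1 : ℝ)} ∩ {q | ε ≤ (q.2 : ℝ)}) := rfl
    rw [h]
    exact isClosed_const.inter ((isClosed_le (by fun_prop) (by fun_prop)).inter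
      (isClosed_le (by fun_prop) (by fun_prop)))
  · intro q hq
    obtain ⟨c, rfl⟩ := Quot.exists_rep q
    exact ⟨c, ⟨hq.1, hq.2.1.le, hq.2.2.le⟩, rfl⟩
  · rintro _ ⟨⟨c, hc, rfl⟩, hcA⟩
    have := hA' c hcA
    exact ⟨hc.1, lt_of_le_of_ne hc.2.1 this.1.symm, lt_of_le_of_ne hc.2.2 this.2.symm⟩

end

/-- A map of the interval that stretches `[ε, 1]` and collapses the rest. -/
noncomputable def stretch (ε : ℝ) (h1 : ε < 1) (x : unitInterval) : unitInterval :=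
  ⟨max 0 ((x - ε) / (1 - ε)), le_max_left _ _, max_le zero_le_one (by
    rw [div_le_one (by linarith)]; linarith [x.2.2])⟩

theorem continuous_stretch (ε : ℝ) (h1 : ε < 1) : Continuous (stretch ε h1) := by
  unfold stretch
  fun_prop

/-- The inverse of `stretch` on `[ε, 1]`. -/
noncomputable def shrink (ε : ℝ) (h0 : 0 ≤ ε) (h1 : ε < 1) (x : unitInterval) : unitInterval :=
  ⟨ε + (1 - ε) * x, by
    have := mul_nonneg (by linarith : 0 ≤ 1 - ε) x.2.1; linarith, by
    have := mul_le_of_le_one_right (by linarith : 0 ≤ 1 - ε) x.2.2; linarith⟩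

theorem stretch_shrink (ε : ℝ) (h0 : 0 ≤ ε) (h1 : ε < 1) (x : unitInterval) :
    stretch ε h1 (shrink ε h0 h1 x) = x := by
  have h : (1 - ε) ≠ 0 := by linarith
  apply Subtype.ext
  simp only [stretch, shrink, add_sub_cancel_left, mul_div_cancel_left₀ _ h]
  exact max_eq_right x.2.1

theorem shrink_stretch (ε : ℝ) (h0 : 0 ≤ ε) (h1 : ε < 1) {x : unitInterval} (hx : ε < x) :
    shrink ε h0 h1 (stretch ε h1 x) = x := by
  have h : (1 - ε) ≠ 0 := by linarith
  have h' : 0 ≤ ((x : ℝ) - ε) / (1 - ε) := div_nonneg (by linarith) (by linarith)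
  apply Subtype.ext
  simp only [stretch, shrink, max_eq_right h', mul_div_cancel₀ _ h]
  ring

theorem stretch_pos_iff (ε : ℝ) (h1 : ε < 1) (x : unitInterval) :
    (0 : ℝ) < stretch ε h1 x ↔ ε < x := by
  simp only [stretch, lt_max_iff, lt_irrefl, false_or]
  rw [div_pos_iff_of_pos_right (by linarith), sub_pos]

/-- The map of the surface that stretches the part of every face around its centre over the face. -/
noncomputable def stretchFaces (ε : ℝ) (h0 : 0 ≤ ε) (h1 : ε < 1) : R.Surface → R.Surface :=
  Quot.map (fun c => ⟨c.1, (stretch ε h1 c.2.1, stretch ε h1 c.2.2)⟩) fun _ _ h => by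
    have e0 : stretch ε h1 0 = 0 := Subtype.ext (by
      simp only [stretch, Set.Icc.coe_zero, zero_sub]
      exact max_eq_left (div_nonpos_of_nonpos_of_nonneg (by linarith) (by linarith)))
    have e1 : stretch ε h1 1 = 1 := Subtype.ext (by
      simp only [stretch, Set.Icc.coe_one]
      rw [div_self (by linarith)]
      exact max_eq_right zero_le_one)
    cases h with
    | halfEdge d t => simp only [e0]; exact Glue.halfEdge d _
    | face a b h t => simp only [e1]; exact Glue.face a b h _

theorem continuous_stretchFaces (ε : ℝ) (h0 : 0 ≤ ε) (h1 : ε < 1) :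
    Continuous (stretchFaces (R := R) ε h0 h1) := by
  refine continuous_quot_lift _ (continuous_quot_mk.comp (continuous_sigma fun e => ?_))
  exact continuous_sigmaMk.comp (((continuous_stretch ε h1).comp continuous_fst).prodMk
    ((continuous_stretch ε h1).comp continuous_snd))

open Classical in
/-- The inverse of `stretchFaces` on the open faces. -/
noncomputable def shrinkFaces (ε : ℝ) (h0 : 0 ≤ ε) (h1 : ε < 1) : R.Surface → Option R.Surface :=
  -- For `ε > 0` the formula does not respect the gluing along half-edges, hence `none` there.
  Quot.lift (fun c => if (0 : ℝ) < c.2.1 ∧ (0 : ℝ) < c.2.2 then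
    some (Quot.mk R.Glue ⟨c.1, (shrink ε h0 h1 c.2.1, shrink ε h0 h1 c.2.2)⟩) else none)
    fun _ _ h => by
      have e1 : shrink ε h0 h1 1 = 1 := Subtype.ext (by simp [shrink])
      cases h with
      | halfEdge d t => simp
      | face a b h t =>
        simp only [Set.Icc.coe_one, zero_lt_one, true_and, and_true, e1]
        rw [Quot.sound (Glue.face a b h _)]

theorem shrinkFaces_stretchFaces {d : G.Dart} {ε : ℝ} {h0 : 0 ≤ ε} {h1 : ε < 1} {p : R.Surface}
    (hp : p ∈ facePart d h0 h1) : shrinkFaces ε h0 h1 (stretchFaces ε h0 h1 p) = some p := by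
  obtain ⟨⟨e, x, y⟩, rfl⟩ := Quot.exists_rep p
  obtain ⟨_, hx, hy⟩ := mk_mem_facePart.mp hp
  refine (if_pos ⟨(stretch_pos_iff ε h1 x).mpr hx, (stretch_pos_iff ε h1 y).mpr hy⟩).trans ?_
  simp only at hx hy
  simp only [shrink_stretch ε h0 h1 hx, shrink_stretch ε h0 h1 hy]

theorem stretchFaces_mem_facePart_iff {d : G.Dart} {ε : ℝ} {h0 : 0 ≤ ε} {h1 : ε < 1}
    {p : R.Surface} : stretchFaces ε h0 h1 p ∈ facePart d le_rfl one_pos ↔ p ∈ facePart d h0 h1 := by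
  obtain ⟨⟨e, x, y⟩, rfl⟩ := Quot.exists_rep p
  exact and_congr Iff.rfl (and_congr (stretch_pos_iff ε h1 x) (stretch_pos_iff ε h1 y))

/-- Stretching is a closed map of the compact Hausdorff surface, and remains closed when restricted
to a preimage. Being bijective there, it is a homeomorphism; continuity of `shrinkFaces` is not
needed. -/
theorem nonempty_facePart_homeomorph [CompactSpace R.Surface] [T2Space R.Surface] (d : G.Dart)
    {ε : ℝ} (h0 : 0 ≤ ε) (h1 : ε < 1) :
    Nonempty (facePart (R := R) d h0 h1 ≃ₜ facePart (R := R) d le_rfl one_pos) := by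
  set r := stretchFaces (R := R) ε h0 h1
  have hr : Continuous r := continuous_stretchFaces ε h0 h1
  have hpre : r ⁻¹' facePart d le_rfl one_pos = facePart d h0 h1 :=
    Set.ext fun p => stretchFaces_mem_facePart_iff
  rw [← hpre]
  have hbij : Function.Bijective ((facePart d le_rfl one_pos).restrictPreimage r) := by
    constructor
    · rintro ⟨p, hp⟩ ⟨q, hq⟩ h
      rw [hpre] at hp hq
      have h' : r p = r q := congrArg Subtype.val h
      have hp' := shrinkFaces_stretchFaces hp
      have hq' := shrinkFaces_stretchFaces hq
      apply Subtype.ext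
      apply Option.some_injective
      show some p = some q
      rw [← hp', ← hq']
      exact congrArg _ h'
    · rintro ⟨p, hp⟩
      obtain ⟨⟨e, x, y⟩, rfl⟩ := Quot.exists_rep p
      have h : r (Quot.mk R.Glue ⟨e, (shrink ε h0 h1 x, shrink ε h0 h1 y)⟩) =
          Quot.mk R.Glue ⟨e, (x, y)⟩ := by
        show Quot.mk R.Glue ⟨e, (stretch ε h1 (shrink ε h0 h1 x), _)⟩ = _
        simp only [stretch_shrink]
      exact ⟨⟨Quot.mk R.Glue ⟨e, (shrink ε h0 h1 x, shrink ε h0 h1 y)⟩, by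
        rw [Set.mem_preimage, h]; exact hp⟩, Subtype.ext h⟩
  exact ⟨(Equiv.ofBijective _ hbij).toHomeomorphOfContinuousClosed
    (hr.restrictPreimage) (hr.isClosedMap.restrictPreimage _)⟩

end RotationSystem

/-! ### Transfer between the abstract surface and `S` -/

namespace GraphEmbedding

variable {V : Type u} {G : SimpleGraph V} {S : Type*} [TopologicalSpace S] {S' : Type*}
  [TopologicalSpace S']

/-- The image of an embedding under a homeomorphism of surfaces. -/
def mapHomeomorph (E : GraphEmbedding G S) (h : S ≃ₜ S') : GraphEmbedding G S' where
  point x := h (E.point x)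
  arc d := (E.arc d).map h.continuous
  arc_symm d := by rw [E.arc_symm]; rfl
  point_injective := h.injective.comp E.point_injective
  arc_injective d := h.injective.comp (E.arc_injective d)
  arc_ne_point d t x hx := E.arc_ne_point d t x (h.injective hx)
  edge_eq_of_arc_eq d e s t hs hs' ht ht' he :=
    E.edge_eq_of_arc_eq d e s t hs hs' ht ht' (h.injective he)

theorem image_mapHomeomorph (E : GraphEmbedding G S) (h : S ≃ₜ S') :
    (E.mapHomeomorph h).image = h '' E.image := by
  rw [image, image, Set.image_union, Set.image_iUnion, ← Set.range_comp]
  congr 1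
  refine Set.iUnion_congr fun d => ?_
  rw [← Set.range_comp]
  rfl

theorem IsCellular.mapHomeomorph {E : GraphEmbedding G S} (hE : E.IsCellular) (h : S ≃ₜ S') :
    (E.mapHomeomorph h).IsCellular := by
  intro x hx
  rw [image_mapHomeomorph, ← Set.image_compl_eq h.bijective] at hx ⊢
  obtain ⟨y, hy, rfl⟩ := hx
  rw [← h.image_connectedComponentIn hy]
  obtain ⟨e⟩ := hE y hy
  exact ⟨(h.image _).symm.trans e⟩

end GraphEmbedding

namespace RotationSystem

open SimpleGraph

variable {V : Type u} {G : SimpleGraph V} {R : RotationSystem G} {S : Type v} [TopologicalSpace S]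

/-- A rotation system prescribes only the first halves of the arcs, but the second half of an arc is
the first half of the reversed one. Each vertex is covered as the origin of some dart. -/
theorem apply_mem_image_iff {E : GraphEmbedding G S} {h : R.Surface ≃ₜ S}
    (hh : ∀ (d : G.Dart) (t : unitInterval),
      h (Quot.mk R.Glue ⟨d, (t, 0)⟩) = (E.arc d).extend ((t : ℝ) / 2))
    (hfst : ∀ v, ∃ d : G.Dart, d.fst = v) {p : R.Surface} :
    h p ∈ E.image ↔ ∃ (d : G.Dart) (t : unitInterval), Quot.mk R.Glue ⟨d, (t, 0)⟩ = p := by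
  have half : ∀ (d : G.Dart) (t : unitInterval) (ht : (t : ℝ) ≤ 1 / 2),
      ∃ s : unitInterval, h (Quot.mk R.Glue ⟨d, (s, 0)⟩) = E.arc d t := by
    intro d t ht
    refine ⟨⟨2 * t, by linarith [t.2.1], by linarith⟩, ?_⟩
    rw [hh, mul_div_cancel_left₀ _ two_ne_zero, Path.extend_apply _ t.2]
  constructor
  · rintro (⟨v, hv⟩ | hp)
    · obtain ⟨d, rfl⟩ := hfst v
      obtain ⟨s, hs⟩ := half d 0 (by simp)
      rw [(E.arc d).source, hv] at hs
      exact ⟨d, s, h.injective hs⟩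
    · rw [Set.mem_iUnion] at hp
      obtain ⟨d, t, ht⟩ := hp
      rcases le_total (t : ℝ) (1 / 2) with h1 | h1
      · obtain ⟨s, hs⟩ := half d t h1
        exact ⟨d, s, h.injective (hs.trans ht)⟩
      · obtain ⟨s, hs⟩ := half d.symm (unitInterval.symm t) (by
          rw [unitInterval.coe_symm_eq]; linarith)
        refine ⟨d.symm, s, h.injective (hs.trans ?_)⟩
        rw [E.arc_symm, ← ht]
        exact congrArg (E.arc d) (unitInterval.symm_symm t)
  · rintro ⟨d, t, rfl⟩
    rw [hh]
    refine Or.inr (Set.mem_iUnion.mpr ⟨d, ?_⟩)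
    rw [← (E.arc d).extend_range]
    exact ⟨_, rfl⟩

/-- The faces of a cellular embedding, as they are described by its rotation system, are disks. -/
theorem nonempty_facePart_homeomorph_ball [Finite G.Dart] [T2Space R.Surface]
    {E : GraphEmbedding G S} (hE : E.IsCellular) (hR : R.IsRotationSystemOf E)
    (hfst : ∀ v, ∃ d : G.Dart, d.fst = v) (d : G.Dart) :
    Nonempty (facePart (R := R) d le_rfl one_pos ≃ₜ
      Metric.ball (0 : EuclideanSpace ℝ (Fin 2)) 1) := by
  obtain ⟨h, hh⟩ := hR
  set A : Set R.Surface := {p | h p ∉ E.image} with hA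
  have hmem : Quot.mk R.Glue ⟨d, (1, 1)⟩ ∈ facePart d le_rfl one_pos :=
    ⟨Relation.EqvGen.refl _, by simp, by simp⟩
  have hsub : facePart d le_rfl one_pos ⊆ A := by
    intro p hp hp'
    obtain ⟨e, t, rfl⟩ := (apply_mem_image_iff hh hfst).mp hp'
    exact absurd (mk_mem_facePart.mp hp).2.2 (by simp)
  have hcomp := connectedComponentIn_eq_facePart hsub (fun c hc => ?_) hmem
  · obtain ⟨e⟩ := hE _ (hsub hmem)
    have himg : h '' A = E.imageᶜ := by
      ext q
      constructor
      · rintro ⟨p, hp, rfl⟩; exact hp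
      · intro hq
        exact ⟨h.symm q, by rw [hA, Set.mem_ofPred_eq, h.apply_symm_apply]; exact hq,
          h.apply_symm_apply q⟩
    rw [← himg, ← h.image_connectedComponentIn (hsub hmem), hcomp] at e
    exact ⟨(h.image _).trans e⟩
  · obtain ⟨e, x, y⟩ := c
    refine ⟨fun hx => hc ?_, fun hy => hc ?_⟩
    · rw [apply_mem_image_iff hh hfst]
      have : x = 0 := Subtype.ext hx
      subst this
      exact ⟨R.next e, y, (Quot.sound (Glue.halfEdge e y)).symm⟩
    · rw [apply_mem_image_iff hh hfst]
      have : y = 0 := Subtype.ext hy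
      subst this
      exact ⟨e, x, rfl⟩

end RotationSystem

/-! ### Cellularity of the drawing -/

namespace RotationSystem.SideChoice

open SimpleGraph Complex

variable {V : Type u} {G : SimpleGraph V} {R : RotationSystem G} (σ : R.SideChoice) {δ : ℕ}

theorem onGridLine_pos {c : R.Corners} :
    OnGridLine δ (σ.pos c) ↔ (c.2.1 : ℝ) ∈ Set.range (gridCoord (δ := δ)) ∨
      (c.2.2 : ℝ) ∈ Set.range (gridCoord (δ := δ)) := by
  rw [pos, onGridLine_quarter_mul, OnGridLine]
  simp

variable [Nonempty R.Surface] [CompactSpace R.Surface]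
  (hσ : Function.Bijective fun d : G.Dart => (d.fst, σ.side d))

include hσ

theorem mk_mem_image_embedding {c : R.Corners} (h : OnGridLine δ (σ.pos c)) :
    Quot.mk R.Glue c ∈ (σ.embedding hσ δ).image :=
  (σ.mem_image_embedding hσ).mpr ⟨_, _, σ.pos_mem c, h, (σ.mk_eq_square hσ c).symm⟩

/-- If the faces of the graph are disks then the blow-up is cellularly embedded. -/
theorem isCellular_embedding [Finite G.Dart] [T2Space R.Surface] (hδ : 1 ≤ δ)
    (hface : ∀ d : G.Dart, Nonempty (facePart (R := R) d le_rfl one_pos ≃ₜ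
      Metric.ball (0 : EuclideanSpace ℝ (Fin 2)) 1)) :
    (σ.embedding hσ δ).IsCellular := by
  have hδ' : (0 : ℝ) < δ := by exact_mod_cast hδ
  have hδ1 : (1 : ℝ) ≤ δ := by exact_mod_cast hδ
  have hinv : (1 : ℝ) / δ ≤ 1 := by rw [div_le_one hδ']; exact hδ1
  have hinv0 : (0 : ℝ) < 1 / δ := by positivity
  -- The last line of a square; no line meets a corner beyond it in both coordinates. For `δ = 1` it
  -- is `0`, and all faces are of the central kind.
  set ε : ℝ := 1 - 1 / δ with hε
  have h0 : 0 ≤ ε := by linarith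
  have h1 : ε < 1 := by linarith
  have hlast : ε ∈ Set.range (gridCoord (δ := δ)) := ⟨⟨δ - 1, by omega⟩, gridCoord_last _⟩
  have hle : ∀ x ∈ Set.range (gridCoord (δ := δ)), x ≤ ε := by
    rintro _ ⟨i, rfl⟩
    exact (le_abs_self _).trans (abs_gridCoord_le i)
  have hcorner : ∀ c : R.Corners, Quot.mk R.Glue c ∈ (σ.embedding hσ δ).imageᶜ →
      (c.2.1 : ℝ) ≠ ε ∧ (c.2.2 : ℝ) ≠ ε := by
    intro c hc
    refine ⟨fun h => hc (σ.mk_mem_image_embedding hσ ?_),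
      fun h => hc (σ.mk_mem_image_embedding hσ ?_)⟩ <;> rw [onGridLine_pos, h]
    · exact Or.inl hlast
    · exact Or.inr hlast
  intro p hp
  obtain ⟨⟨e, x, y⟩, rfl⟩ := Quot.exists_rep p
  have hne := hcorner _ hp
  simp only at hne
  by_cases hxy : ε < x ∧ ε < y
  · have hsub : facePart e h0 h1 ⊆ (σ.embedding hσ δ).imageᶜ := by
      intro q hq hq'
      obtain ⟨v, z, hz, hline, rfl⟩ := (σ.mem_image_embedding hσ).mp hq'
      obtain ⟨c, rfl, rfl⟩ := σ.exists_corner hσ v hz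
      rw [← σ.mk_eq_square hσ, mk_mem_facePart] at hq
      rcases (σ.onGridLine_pos).mp hline with h | h
      · exact absurd (hle _ h) (not_le.mpr hq.2.1)
      · exact absurd (hle _ h) (not_le.mpr hq.2.2)
    have hmem : Quot.mk R.Glue ⟨e, (x, y)⟩ ∈ facePart e h0 h1 :=
      ⟨Relation.EqvGen.refl _, hxy⟩
    rw [connectedComponentIn_eq_facePart hsub hcorner hmem]
    obtain ⟨g⟩ := nonempty_facePart_homeomorph (R := R) e h0 h1
    obtain ⟨g'⟩ := hface e
    exact ⟨g.trans g'⟩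
  · have hx := x.2
    have hy := y.2
    by_cases hyε : ε < y
    · have hxε : (x : ℝ) < ε := lt_of_le_of_ne (not_lt.mp fun h => hxy ⟨h, hyε⟩) hne.1
      -- The chart must have the coordinate below `ε` as its transverse one. Here this is `x`, so
      -- the dart `R.next e` is used; in the remaining case it is `y`, and `e` serves.
      have heq : Quot.mk R.Glue ⟨e, (x, y)⟩ =
          σ.double (R.next e) (1 - ((y : ℝ) - (x : ℝ) * I)) := by
        rw [σ.mk_eq_square hσ, σ.double_of_nonneg, R.next_fst, σ.side_next, quarter.add,
          quarter.one, pos, sub_sub_cancel]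
        · congr 1
          linear_combination (quarter (σ.side e) * (x : ℝ)) * I_mul_I
        · simp; exact hy.2
      rw [heq] at hp ⊢
      refine σ.nonempty_homeomorph_of_double hσ hδ _ ?_ ?_ hp
      · simp; rw [abs_of_nonneg (by linarith [hy.2])]
        have : (1 : ℝ) / δ = (δ : ℝ)⁻¹ := one_div _
        linarith [hx.1]
      · simp only [sub_im, one_im, ofReal_im, im_ofReal_mul, I_im]
        rw [abs_lt]; constructor <;> linarith [hx.1]
    · have hyε : (y : ℝ) < ε := lt_of_le_of_ne (not_lt.mp hyε) hne.2
      have heq : Quot.mk R.Glue ⟨e, (x, y)⟩ =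
          σ.double e (1 - ((x : ℝ) + (y : ℝ) * I)) := by
        rw [σ.mk_eq_square hσ, σ.double_of_nonneg, pos, sub_sub_cancel]
        simp; exact hx.2
      rw [heq] at hp ⊢
      refine σ.nonempty_homeomorph_of_double hσ hδ _ ?_ ?_ hp
      · simp; rw [abs_of_nonneg (by linarith [hx.2])]
        have : (1 : ℝ) / δ = (δ : ℝ)⁻¹ := one_div _
        linarith [hx.1, hy.1]
      · simp only [sub_im, one_im, add_im, ofReal_im, im_ofReal_mul, I_im]
        rw [abs_lt]; constructor <;> linarith [hy.1]

end RotationSystem.SideChoice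

/-- For every constant `c < 1` there is a constant `C > 0`, depending on `c` only, such that for
every four-regular graph `G` with `λ(G) / 4 < c`, every cellular embedding `E` of `G` on a
closed (orientable) surface `S`, with rotation system `R`, and every `δ ≥ 1`, the blow-up `G^δ` is
cellularly embeddable on `S`, has `δ² |V(G)|` vertices and treewidth at least `C δ |V(G)|`. -/
theorem lemma6p2 (c : ℝ) (hc : c < 1) :
    ∃ C : ℝ, 0 < C ∧
      ∀ (V : Type u) [Fintype V] [DecidableEq V] (G : SimpleGraph V) [DecidableRel G.Adj]
        (S : Type v) [TopologicalSpace S] [T2Space S] [CompactSpace S] [ConnectedSpace S]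
        [ChartedSpace (EuclideanSpace ℝ (Fin 2)) S]
        (E : GraphEmbedding G S) (R : RotationSystem G) (σ : R.SideChoice) (δ : ℕ),
        G.IsRegularOfDegree 4 → E.IsCellular → R.IsRotationSystemOf E →
        G.secondEigenvalue / 4 < c → 1 ≤ δ →
          (σ.blowUp δ).CellularlyEmbeddable S ∧
          Fintype.card (V × (Fin δ × Fin δ)) = δ ^ 2 * Fintype.card V ∧
          C * δ * Fintype.card V ≤ (σ.blowUp δ).treewidth := by
  have ha : 0 < 1 - c := by linarith
  -- In the denominator `32 = 16 * 2`: one factor from the threshold for good vertices, one from the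
  -- passage from bag size to treewidth.
  refine ⟨(2 / 5 * (1 - c)) / (32 * (1 + 2 / 5 * (1 - c))), by positivity, ?_⟩
  intro V _ _ G _ S _ _ _ _ _ E R σ δ hG hE hR hlam hδ
  have hσ := σ.bijective_fst_side hG
  obtain ⟨h, -⟩ := id hR
  have : CompactSpace R.Surface := h.symm.compactSpace
  have : T2Space R.Surface := h.isEmbedding.t2Space
  have : Nonempty R.Surface := ⟨h.symm (Classical.arbitrary S)⟩
  have : Nonempty V := by
    obtain ⟨c, -⟩ := Quot.exists_rep (Classical.arbitrary R.Surface)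
    exact ⟨c.1.fst⟩
  refine ⟨⟨(σ.embedding hσ δ).mapHomeomorph h, ?_⟩, ?_, σ.le_treewidth_blowUp hδ hG hc hlam⟩
  · refine (σ.isCellular_embedding hσ hδ fun d => ?_).mapHomeomorph h
    refine RotationSystem.nonempty_facePart_homeomorph_ball hE hR (fun v => ?_) d
    obtain ⟨d, hd⟩ := hσ.2 (v, 0)
    exact ⟨d, congrArg Prod.fst hd⟩
  · rw [Fintype.card_prod, Fintype.card_prod, Fintype.card_fin]
    ring
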